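/- Let $L>0$ and $\mathrm{K}=[0,L]^2\subset\mathbb{R}^2$ (in particular $\mathrm{K}=[0,1]^2$). For a real distribution $T\in\mathcal{D}'(\mathbb{R}^2)$ let $\|T\|_{\mathcal{M}}$ be the total variation norm of $T$ if $T$ is a bounded signed Borel measure, and $\|T\|_{\mathcal{M}}=\infty$ otherwise. For $f\in\mathcal{D}'(\mathbb{R}^2)$ put, with distributional derivatives, $$[\mathrm{D}\otimes\mathrm{D}]\{f\}=\partial_1\partial_2 f,\qquad \|\nabla\{f\}\|_{\mathcal{M}^2}=\|\partial_1 f\|_{\mathcal{M}}+\|\partial_2 f\|_{\mathcal{M}}.$$ Let $\mathcal{M}_{\mathrm{D}\otimes\mathrm{D},0}(\mathrm{K})$ be the set of all $f\in\mathcal{D}'(\mathbb{R}^2)$ such that $[\mathrm{D}\otimes\mathrm{D}]\{f\}$ is a bounded measure supported in $\mathrm{K}$ and $\langle f,\varphi\rangle=0$ for all $\varphi\in C_c^\infty(\mathbb{R}^2\setminus\mathrm{K})$. Call a Lebesgue measurable set $A\subset\mathrm{K}$ admissible if $\mathbb{1}_A\in\mathcal{M}_{\mathrm{D}\otimes\mathrm{D},0}(\mathrm{K})$.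 An admissible set $A$ is $\nabla$-decomposable if there is a partition $A=A_1\cup A_2$ into two disjoint admissible sets with $|A_1|>0$, $|A_2|>0$ and $$\|\nabla\{\mathbb{1}_{A_1}\}\|_{\mathcal{M}^2}+\|\nabla\{\mathbb{1}_{A_2}\}\|_{\mathcal{M}^2}=\|\nabla\{\mathbb{1}_{A}\}\|_{\mathcal{M}^2}<\infty;$$ it is $[\mathrm{D}\otimes\mathrm{D}]$-decomposable if there is such a partition with, instead, $$\|[\mathrm{D}\otimes\mathrm{D}]\{\mathbb{1}_{A_1}\}\|_{\mathcal{M}}+\|[\mathrm{D}\otimes\mathrm{D}]\{\mathbb{1}_{A_2}\}\|_{\mathcal{M}}=\|[\mathrm{D}\otimes\mathrm{D}]\{\mathbb{1}_{A}\}\|_{\mathcal{M}}<\infty.$$ Let $\mathcal{E}_{\nabla}$ and $\mathcal{E}_{\mathrm{D}\otimes\mathrm{D}}$ be the families of admissible sets that are not $\nabla$-decomposable (the $\nabla$-indecomposable sets), respectively not $[\mathrm{D}\otimes\mathrm{D}]$-decomposable (the $[\mathrm{D}\otimes\mathrm{D}]$-indecomposable sets). Then the strict inclusion $\mathcal{E}_{\mathrm{D}\otimes\mathrm{D}}\subsetneq\mathcal{E}_{\nabla}$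 holds. Moreover, for every $c>0$ with $3c\le L$, the union of two rectangles $$A=\big([0,3c]\times[0,c]\big)\cup\big([c,2c]\times[c,2c]\big)$$ is $\nabla$-indecomposable but $[\mathrm{D}\otimes\mathrm{D}]$-decomposable. -/

import Mathlib

open MeasureTheory Set
open scoped ENNReal Distributions LineDeriv

namespace MixedDeriv

/-- The plane, with the Lebesgue measure `volume`. -/
abbrev Plane : Type := ℝ × ℝ

/-- `𝒟'(ℝ²)`: real distributions on the whole plane. -/
abbrev PlaneDistribution : Type := 𝓓'((⊤ : TopologicalSpace.Opens Plane), ℝ)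

/-- The distributional derivative `[D ⊗ I]{f}` (with respect to the first variable). -/
noncomputable def D₁ (f : PlaneDistribution) : PlaneDistribution := ∂_{((1, 0) : Plane)} f

/-- The distributional derivative `[I ⊗ D]{f}` (with respect to the second variable). -/
noncomputable def D₂ (f : PlaneDistribution) : PlaneDistribution := ∂_{((0, 1) : Plane)} f

/-- The distributional mixed derivative `[D ⊗ D]{f}`. -/
noncomputable def DD (f : PlaneDistribution) : PlaneDistribution := D₁ (D₂ f)

/-- The distribution `T` is the bounded (signed Borel) measure `m`: `⟨T, φ⟩ = ∫ φ dm` for every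
test function `φ`. -/
def IsGivenBy (T : PlaneDistribution) (m : SignedMeasure Plane) : Prop :=
  ∀ φ : 𝓓((⊤ : TopologicalSpace.Opens Plane), ℝ), T φ = ∫ᵛ x, φ x ∂•m

/-- `‖T‖_𝓜`: the total variation of the bounded measure `m` that `T` is, and `∞` when `T` is not
a bounded measure. (There is at most one such `m`.) -/
noncomputable def measureNorm (T : PlaneDistribution) : ℝ≥0∞ :=
  ⨅ (m : SignedMeasure Plane) (_ : IsGivenBy T m), m.totalVariation univ

/-- The anisotropic total variation `‖∇{f}‖ = ‖[I ⊗ D]{f}‖ + ‖[D ⊗ I]{f}‖`. -/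
noncomputable def gradNorm (f : PlaneDistribution) : ℝ≥0∞ :=
  measureNorm (D₂ f) + measureNorm (D₁ f)

/-- `‖[D ⊗ D]{f}‖`. -/
noncomputable def mixedNorm (f : PlaneDistribution) : ℝ≥0∞ := measureNorm (DD f)

/-- The native space `𝓜_{D⊗D,0}(K)`: distributions `f` for which `[D ⊗ D]{f}` is a bounded measure
supported in `K`, and which vanish on all test functions supported in the complement of `K`. -/
def nativeSpace (K : Set Plane) : Set PlaneDistribution :=
  {f | (∃ m : SignedMeasure Plane, m.totalVariation Kᶜ = 0 ∧ IsGivenBy (DD f) m) ∧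
    Distribution.IsVanishingOn f Kᶜ}

/-- The indicator function of a (Lebesgue measurable) set `A`, as a distribution:
`φ ↦ ∫ φ 1_A`. -/
noncomputable def indicatorDistribution (A : Set Plane) : PlaneDistribution :=
  ContinuousLinearMap.toUniformConvergenceCLM _ _ _
    (TestFunction.integralAgainstBilinCLM (ContinuousLinearMap.mul ℝ ℝ) volume
      (A.indicator fun _ => (1 : ℝ)))

/-- `A ⊆ K` is a Lebesgue measurable set with `1_A ∈ 𝓜_{D⊗D,0}(K)`. -/
structure IsAdmissible (K A : Set Plane) : Prop where
  subset : A ⊆ K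
  nullMeasurable : NullMeasurableSet A volume
  mem : indicatorDistribution A ∈ nativeSpace K

/-- `A` is decomposable in `K` for the functional `N`: it is the disjoint union of two admissible
sets of positive area for which `N` of the indicator functions is finite and adds up. -/
def IsDecomposable (N : PlaneDistribution → ℝ≥0∞) (K A : Set Plane) : Prop :=
  ∃ A₁ A₂ : Set Plane, Disjoint A₁ A₂ ∧ A₁ ∪ A₂ = A ∧ IsAdmissible K A₁ ∧ IsAdmissible K A₂ ∧
    N (indicatorDistribution A₁) + N (indicatorDistribution A₂) = N (indicatorDistribution A) ∧
    N (indicatorDistribution A) < ∞ ∧ 0 < volume A₁ ∧ 0 < volume A₂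

/-- `∇`-decomposable sets. -/
def IsGradDecomposable (K A : Set Plane) : Prop := IsDecomposable gradNorm K A

/-- `[D ⊗ D]`-decomposable sets. -/
def IsMixedDecomposable (K A : Set Plane) : Prop := IsDecomposable mixedNorm K A

/-- `𝓔_∇`: the `∇`-indecomposable sets. -/
def gradIndecomposable (K : Set Plane) : Set (Set Plane) :=
  {A | IsAdmissible K A ∧ ¬ IsGradDecomposable K A}

/-- `𝓔_{D⊗D}`: the `[D ⊗ D]`-indecomposable sets. -/
def mixedIndecomposable (K : Set Plane) : Set (Set Plane) :=
  {A | IsAdmissible K A ∧ ¬ IsMixedDecomposable K A}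

/-- The square `[0, L]²`. -/
def square (L : ℝ) : Set Plane := Icc 0 L ×ˢ Icc 0 L

/-- The union of the rectangle `[0, 3c] × [0, c]` and of the square `[c, 2c] × [c, 2c]` on top
of it. -/
def twoRectangles (c : ℝ) : Set Plane :=
  (Icc 0 (3 * c) ×ˢ Icc 0 c) ∪ (Icc c (2 * c) ×ˢ Icc c (2 * c))

end MixedDeriv

namespace MixedDeriv

open Filter Topology

/-! The inclusion holds because an admissible set has a very rigid mixed derivative. If `m` is the
mixed derivative of `1_A`, then `1_A` agrees almost everywhere with the distribution function of `m`
(`indicator_ae_eq_cdf`): both have the same mixed derivative and both vanish outside the first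
quadrant. Distribution functions are continuous from the upper right, so `cdf m` takes only the
values 0 and 1 everywhere. Hence `m` is integer valued on closed lower quadrants, then on all Borel
sets, and an integer-valued bounded measure on a compact set has finitely many atoms (`exists_int`,
`exists_finite`).

Near a point `p` the function `cdf m` is therefore constant on each of four quadrants. Its four
values `corner m p b c` determine both the atom `m {p}`, as their alternating sum, and the densities
of the gradient along the four half-edges at `p`, as differences of neighbours. If the gradient
norms of two disjoint sets add up, their jumps across a common half-edge cannot have opposite signs
(`jump_mul_nonneg`). Together with disjointness this excludes opposite atoms
(`apply_singleton_mul_nonneg`), so the mixed norms add up for the same partition.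

Strictness comes from the two rectangles. The corners of the two pieces are distinct points, so the
mixed norms add. For the gradient, inside a connected open set filled by two disjoint pieces every
jump of one piece is the opposite jump of the other. Additivity then forbids all jumps, and one
piece is null (`not_isGradDecomposable_of_isPreconnected`). -/

/-- Smooth compactly supported functions of one real variable. -/
abbrev LineTest : Type := 𝓓((⊤ : TopologicalSpace.Opens ℝ), ℝ)

/-- Smooth compactly supported functions on the plane. -/
abbrev PlaneTest : Type := 𝓓((⊤ : TopologicalSpace.Opens Plane), ℝ)

/-! ### Product test functions and partial derivatives -/

/-- The product test function `(x, y) ↦ α x * β y`. -/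
noncomputable def tensor (α β : LineTest) : PlaneTest where
  toFun p := α p.1 * β p.2
  contDiff' := (α.contDiff.comp contDiff_fst).mul (β.contDiff.comp contDiff_snd)
  hasCompactSupport' := by
    refine HasCompactSupport.intro (α.hasCompactSupport.prod β.hasCompactSupport) ?_
    intro p hp
    by_cases h1 : p.1 ∈ tsupport α
    · have h2 : p.2 ∉ tsupport β := fun h2 => hp ⟨h1, h2⟩
      rw [image_eq_zero_of_notMem_tsupport h2, mul_zero]
    · rw [image_eq_zero_of_notMem_tsupport h1, zero_mul]
  tsupport_subset' := fun _ _ => trivial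

@[simp] lemma tensor_apply (α β : LineTest) (p : Plane) : tensor α β p = α p.1 * β p.2 := rfl

/-- The derivative of a one-variable test function, as a test function. -/
noncomputable def derivTest (α : LineTest) : LineTest := ∂_{(1 : ℝ)} α

lemma LineTest.differentiable (α : LineTest) : Differentiable ℝ α :=
  α.contDiff.differentiable (by simp)

@[simp] lemma derivTest_apply (α : LineTest) (x : ℝ) : derivTest α x = deriv α x := by
  have : derivTest α x = lineDeriv ℝ α x 1 := by
    simp [derivTest, TestFunction.lineDerivOp_eq_lineDerivCLM ℝ]
  rw [this, (LineTest.differentiable α x).lineDeriv_eq_fderiv, fderiv_apply_one_eq_deriv]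

lemma PlaneTest.differentiable (φ : PlaneTest) : Differentiable ℝ φ :=
  φ.contDiff.differentiable (by simp)

lemma lineDeriv_fst_apply (φ : PlaneTest) (p : Plane) :
    (∂_{((1, 0) : Plane)} φ) p = deriv (fun t => φ (t, p.2)) p.1 := by
  have : (∂_{((1, 0) : Plane)} φ) p = lineDeriv ℝ φ p (1, 0) := by
    simp [TestFunction.lineDerivOp_eq_lineDerivCLM ℝ]
  rw [this, (PlaneTest.differentiable φ p).lineDeriv_eq_fderiv]
  have h : HasDerivAt (fun t : ℝ => ((t, p.2) : Plane)) (1, 0) p.1 :=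
    (hasDerivAt_id p.1).prodMk (hasDerivAt_const _ _)
  exact (((PlaneTest.differentiable φ p).hasFDerivAt).comp_hasDerivAt p.1 h).deriv.symm

lemma lineDeriv_snd_apply (φ : PlaneTest) (p : Plane) :
    (∂_{((0, 1) : Plane)} φ) p = deriv (fun t => φ (p.1, t)) p.2 := by
  have : (∂_{((0, 1) : Plane)} φ) p = lineDeriv ℝ φ p (0, 1) := by
    simp [TestFunction.lineDerivOp_eq_lineDerivCLM ℝ]
  rw [this, (PlaneTest.differentiable φ p).lineDeriv_eq_fderiv]
  have h : HasDerivAt (fun t : ℝ => ((p.1, t) : Plane)) (0, 1) p.2 :=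
    (hasDerivAt_const _ _).prodMk (hasDerivAt_id p.2)
  exact (((PlaneTest.differentiable φ p).hasFDerivAt).comp_hasDerivAt p.2 h).deriv.symm

lemma lineDeriv_fst_tensor (α β : LineTest) :
    ∂_{((1, 0) : Plane)} (tensor α β) = tensor (derivTest α) β := by
  ext p
  simp [lineDeriv_fst_apply]

lemma lineDeriv_snd_tensor (α β : LineTest) :
    ∂_{((0, 1) : Plane)} (tensor α β) = tensor α (derivTest β) := by
  ext p
  simp [lineDeriv_snd_apply]

/-! ### Approximating indicators of intervals -/

/-- A sequence of test functions increasing to the indicator of `Ioo a b`. -/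
noncomputable def bump (a b : ℝ) (n : ℕ) : LineTest where
  toFun t := Real.smoothTransition (n * (t - a)) * Real.smoothTransition (n * (b - t))
  contDiff' := by
    refine (Real.smoothTransition.contDiff.comp ?_).mul (Real.smoothTransition.contDiff.comp ?_)
    · exact contDiff_const.mul (contDiff_id.sub contDiff_const)
    · exact contDiff_const.mul (contDiff_const.sub contDiff_id)
  hasCompactSupport' := by
    refine HasCompactSupport.intro (isCompact_Icc (a := a) (b := b)) ?_
    intro t ht
    by_cases h : a ≤ t
    · have h2 : b < t := by by_contra h2; exact ht ⟨h, not_lt.1 h2⟩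
      rw [Real.smoothTransition.zero_of_nonpos (x := n * (b - t)), mul_zero]
      exact mul_nonpos_of_nonneg_of_nonpos n.cast_nonneg (by linarith)
    · rw [Real.smoothTransition.zero_of_nonpos (x := n * (t - a)), zero_mul]
      exact mul_nonpos_of_nonneg_of_nonpos n.cast_nonneg (by linarith)
  tsupport_subset' := fun _ _ => trivial

lemma bump_apply (a b : ℝ) (n : ℕ) (t : ℝ) : bump a b n t =
    Real.smoothTransition (n * (t - a)) * Real.smoothTransition (n * (b - t)) := rfl

lemma bump_eq_zero {a b : ℝ} (n : ℕ) {t : ℝ} (ht : t ∉ Ioo a b) : bump a b n t = 0 := by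
  rw [bump_apply]
  by_cases h : a < t
  · have h2 : b ≤ t := by by_contra h2; exact ht ⟨h, not_le.1 h2⟩
    rw [Real.smoothTransition.zero_of_nonpos (x := n * (b - t)), mul_zero]
    exact mul_nonpos_of_nonneg_of_nonpos n.cast_nonneg (by linarith)
  · rw [Real.smoothTransition.zero_of_nonpos (x := n * (t - a)), zero_mul]
    exact mul_nonpos_of_nonneg_of_nonpos n.cast_nonneg (by linarith)

lemma bump_nonneg (a b : ℝ) (n : ℕ) (t : ℝ) : 0 ≤ bump a b n t :=
  mul_nonneg (Real.smoothTransition.nonneg _) (Real.smoothTransition.nonneg _)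

lemma bump_le_one (a b : ℝ) (n : ℕ) (t : ℝ) : bump a b n t ≤ 1 :=
  mul_le_one₀ (Real.smoothTransition.le_one _) (Real.smoothTransition.nonneg _)
    (Real.smoothTransition.le_one _)

lemma bump_pos {a b : ℝ} {n : ℕ} (hn : 0 < n) {t : ℝ} (ht : t ∈ Ioo a b) : 0 < bump a b n t := by
  have hn' : (0 : ℝ) < n := Nat.cast_pos.2 hn
  exact mul_pos (Real.smoothTransition.pos_of_pos (mul_pos hn' (sub_pos.2 ht.1)))
    (Real.smoothTransition.pos_of_pos (mul_pos hn' (sub_pos.2 ht.2)))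

lemma tendsto_bump (a b t : ℝ) :
    Tendsto (fun n => bump a b n t) atTop (𝓝 ((Ioo a b).indicator 1 t)) := by
  by_cases ht : t ∈ Ioo a b
  · rw [indicator_of_mem ht]
    refine tendsto_const_nhds.congr' ?_
    have key : ∀ d : ℝ, 0 < d → ∀ᶠ n : ℕ in atTop, 1 ≤ n * d := fun d hd =>
      (tendsto_natCast_atTop_atTop.atTop_mul_const hd).eventually_ge_atTop 1
    filter_upwards [key _ (sub_pos.2 ht.1), key _ (sub_pos.2 ht.2)] with n h1 h2
    rw [bump_apply, Real.smoothTransition.one_of_one_le h1, Real.smoothTransition.one_of_one_le h2]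
    simp
  · rw [indicator_of_notMem ht]
    exact tendsto_const_nhds.congr fun n => (bump_eq_zero n ht).symm

lemma tendsto_tensor_bump (a b c d : ℝ) (p : Plane) :
    Tendsto (fun n => tensor (bump a b n) (bump c d n) p) atTop
      (𝓝 ((Ioo a b ×ˢ Ioo c d).indicator 1 p)) := by
  have h := (tendsto_bump a b p.1).mul (tendsto_bump c d p.2)
  have e : (Ioo a b ×ˢ Ioo c d).indicator (1 : Plane → ℝ) p =
      (Ioo a b).indicator 1 p.1 * (Ioo c d).indicator 1 p.2 :=
    Set.indicator_prod_one
  rw [e]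
  exact h

lemma abs_tensor_bump_le (a b c d : ℝ) (n : ℕ) (p : Plane) :
    ‖tensor (bump a b n) (bump c d n) p‖ ≤ 1 := by
  rw [tensor_apply, Real.norm_of_nonneg (mul_nonneg (bump_nonneg ..) (bump_nonneg ..))]
  exact mul_le_one₀ (bump_le_one ..) (bump_nonneg ..) (bump_le_one ..)

/-! ### Signed measures on the plane and product test functions -/

instance isFiniteMeasure_variation {X : Type*} [MeasurableSpace X] (m : SignedMeasure X) :
    IsFiniteMeasure m.variation := by
  rw [← SignedMeasure.totalVariation_eq_variation]; infer_instance

lemma PlaneTest.integrable_vectorMeasure (φ : PlaneTest) (m : SignedMeasure Plane) :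
    m.Integrable φ :=
  φ.continuous.integrable_of_hasCompactSupport φ.hasCompactSupport

lemma vectorIntegral_indicator_one {X : Type*} [MeasurableSpace X] (m : SignedMeasure X)
    {s : Set X} (hs : MeasurableSet s) : ∫ᵛ x, s.indicator (1 : X → ℝ) x ∂•m = m s := by
  rw [VectorMeasure.integral_indicator hs]
  simp [VectorMeasure.integral_const, VectorMeasure.restrict_apply, hs]

lemma tendsto_integral_tensor_bump (m : SignedMeasure Plane) (a b c d : ℝ) :
    Tendsto (fun n => ∫ᵛ p, tensor (bump a b n) (bump c d n) p ∂•m) atTop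
      (𝓝 (m (Ioo a b ×ˢ Ioo c d))) := by
  rw [← vectorIntegral_indicator_one m (measurableSet_Ioo.prod measurableSet_Ioo)]
  refine VectorMeasure.tendsto_integral_filter_of_norm_le_const
    (Eventually.of_forall fun n => (tensor _ _).continuous.aestronglyMeasurable)
    ⟨1, Eventually.of_forall fun n => Eventually.of_forall fun p => abs_tensor_bump_le a b c d n p⟩
    (Eventually.of_forall fun p => tendsto_tensor_bump a b c d p)

lemma isPiSystem_range_Ioo : IsPiSystem (range fun x : ℝ × ℝ => Ioo x.1 x.2) := by
  rintro _ ⟨x, rfl⟩ _ ⟨y, rfl⟩ -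
  exact ⟨(max x.1 y.1, min x.2 y.2), by simp [Ioo_inter_Ioo]⟩

lemma generateFrom_range_Ioo :
    MeasurableSpace.generateFrom (range fun x : ℝ × ℝ => Ioo x.1 x.2) = Real.measurableSpace := by
  refine le_antisymm (MeasurableSpace.generateFrom_le ?_) ?_
  · rintro _ ⟨x, rfl⟩; exact measurableSet_Ioo
  · rw [show Real.measurableSpace = borel ℝ from rfl, Real.borel_eq_generateFrom_Ioo_rat]
    refine MeasurableSpace.generateFrom_mono ?_
    intro s hs
    simp only [mem_iUnion, mem_singleton_iff] at hs
    obtain ⟨a, b, -, rfl⟩ := hs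
    exact ⟨(a, b), rfl⟩

lemma isCountablySpanning_range_Ioo :
    IsCountablySpanning (range fun x : ℝ × ℝ => Ioo x.1 x.2) := by
  refine ⟨fun n : ℕ => Ioo (-n : ℝ) n, fun n => ⟨(-n, n), rfl⟩, ?_⟩
  refine eq_univ_of_forall fun x => ?_
  obtain ⟨n, hn⟩ := exists_nat_gt |x|
  exact mem_iUnion.2 ⟨n, abs_lt.1 hn⟩

/-- Bounded open boxes form a generating π-system. The total mass is a separate hypothesis because
the plane is not a box. -/
lemma signedMeasure_eq_zero_of_boxes (m : SignedMeasure Plane)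
    (huniv : m univ = 0) (h : ∀ a b c d : ℝ, m (Ioo a b ×ˢ Ioo c d) = 0) : m = 0 := by
  refine VectorMeasure.ext_of_generateFrom _ ?_
    (generateFrom_eq_prod generateFrom_range_Ioo generateFrom_range_Ioo
      isCountablySpanning_range_Ioo isCountablySpanning_range_Ioo).symm
    (isPiSystem_range_Ioo.prod isPiSystem_range_Ioo) ?_
  · rintro _ ⟨_, ⟨x, rfl⟩, _, ⟨y, rfl⟩, rfl⟩
    simpa using h x.1 x.2 y.1 y.2
  · simpa using huniv

/-- A signed measure which annihilates the product test functions supported in an open box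
vanishes on that box. -/
lemma variation_box_eq_zero (m : SignedMeasure Plane) (a b c d : ℝ)
    (h : ∀ α β : LineTest, (∀ t ∉ Ioo a b, α t = 0) → (∀ t ∉ Ioo c d, β t = 0) →
      ∫ᵛ p, tensor α β p ∂•m = 0) : m.variation (Ioo a b ×ˢ Ioo c d) = 0 := by
  have hU : MeasurableSet (Ioo a b ×ˢ Ioo c d) := measurableSet_Ioo.prod measurableSet_Ioo
  -- An intersection of boxes is a box inside the given one, so its measure is a limit of integrals
  -- of admissible bump products.
  have key : ∀ a' b' c' d' : ℝ, m (Ioo a' b' ×ˢ Ioo c' d' ∩ Ioo a b ×ˢ Ioo c d) = 0 := by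
    intro a' b' c' d'
    rw [prod_inter_prod, Ioo_inter_Ioo, Ioo_inter_Ioo]
    refine tendsto_nhds_unique (tendsto_integral_tensor_bump m _ _ _ _)
      (tendsto_const_nhds.congr fun n => (h _ _ ?_ ?_).symm)
    · intro t ht
      refine bump_eq_zero n fun h => ht ?_
      rw [← Ioo_inter_Ioo] at h; exact h.2
    · intro t ht
      refine bump_eq_zero n fun h => ht ?_
      rw [← Ioo_inter_Ioo] at h; exact h.2
  have h0 : m.restrict (Ioo a b ×ˢ Ioo c d) = 0 := by
    refine signedMeasure_eq_zero_of_boxes _ ?_ ?_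
    · rw [VectorMeasure.restrict_apply _ hU .univ, univ_inter]
      simpa using key a b c d
    · intro a' b' c' d'
      rw [VectorMeasure.restrict_apply _ hU (measurableSet_Ioo.prod measurableSet_Ioo)]
      exact key a' b' c' d'
  have := VectorMeasure.variation_restrict (μ := m) hU
  rw [h0, VectorMeasure.variation_zero] at this
  exact Measure.restrict_eq_zero.1 this.symm

lemma signedMeasure_eq_zero_of_tensor (m : SignedMeasure Plane)
    (h : ∀ α β : LineTest, ∫ᵛ p, tensor α β p ∂•m = 0) : m = 0 := by
  rw [← VectorMeasure.variation_eq_zero, ← Measure.measure_univ_eq_zero]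
  have : (univ : Set Plane) = ⋃ n : ℕ, Ioo (-n : ℝ) n ×ˢ Ioo (-n : ℝ) n := by
    refine (eq_univ_of_forall fun p => ?_).symm
    obtain ⟨n, hn⟩ := exists_nat_gt (max |p.1| |p.2|)
    exact mem_iUnion.2 ⟨n, abs_lt.1 ((le_max_left _ _).trans_lt hn),
      abs_lt.1 ((le_max_right _ _).trans_lt hn)⟩
  rw [this, measure_iUnion_null_iff]
  exact fun n => variation_box_eq_zero m _ _ _ _ fun α β _ _ => h α β

lemma IsGivenBy.unique {T : PlaneDistribution} {m m' : SignedMeasure Plane}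
    (h : IsGivenBy T m) (h' : IsGivenBy T m') : m = m' := by
  rw [← sub_eq_zero]
  refine signedMeasure_eq_zero_of_tensor _ fun α β => ?_
  rw [VectorMeasure.integral_sub_vectorMeasure (PlaneTest.integrable_vectorMeasure _ _)
    (PlaneTest.integrable_vectorMeasure _ _), ← h, ← h', sub_self]

lemma IsGivenBy.add {T T' : PlaneDistribution} {m m' : SignedMeasure Plane}
    (h : IsGivenBy T m) (h' : IsGivenBy T' m') : IsGivenBy (T + T') (m + m') := fun φ => by
  rw [VectorMeasure.integral_add_vectorMeasure (PlaneTest.integrable_vectorMeasure _ _)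
    (PlaneTest.integrable_vectorMeasure _ _), ← h, ← h']
  rfl

/-- By uniqueness of the representing measure, the infimum runs over a single measure. -/
lemma IsGivenBy.measureNorm_eq {T : PlaneDistribution} {m : SignedMeasure Plane}
    (h : IsGivenBy T m) : measureNorm T = m.variation univ := by
  rw [← SignedMeasure.totalVariation_eq_variation]
  refine le_antisymm (iInf₂_le m h) (le_iInf₂ fun m' h' => ?_)
  rw [h.unique h']

lemma exists_isGivenBy {T : PlaneDistribution} (h : measureNorm T < ∞) : ∃ m, IsGivenBy T m := by
  by_contra! hm
  simp [measureNorm, hm] at h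

/-! ### Indicator functions as distributions -/

lemma locallyIntegrableOn_indicator {A : Set Plane} (hA : NullMeasurableSet A volume) :
    LocallyIntegrableOn (A.indicator fun _ => (1 : ℝ))
      ((⊤ : TopologicalSpace.Opens Plane) : Set Plane) volume := by
  have h : LocallyIntegrable (fun _ : Plane => (1 : ℝ)) volume := locallyIntegrable_const 1
  refine LocallyIntegrable.locallyIntegrableOn (fun x => ?_) _
  obtain ⟨s, hs, hi⟩ := h x
  refine ⟨s, hs, Integrable.mono hi ?_ ?_⟩
  · exact (aestronglyMeasurable_const.indicator₀ hA).mono_measure Measure.restrict_le_self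
  · exact Eventually.of_forall fun y => norm_indicator_le_norm_self _ _

lemma indicatorDistribution_apply {A : Set Plane} (hA : NullMeasurableSet A volume)
    (φ : PlaneTest) :
    indicatorDistribution A φ = ∫ p, φ p * A.indicator 1 p :=
  TestFunction.integralAgainstBilinCLM_eq_integral (locallyIntegrableOn_indicator hA)

lemma indicatorDistribution_congr {A B : Set Plane} (hA : NullMeasurableSet A volume)
    (h : A =ᵐ[volume] B) : indicatorDistribution A = indicatorDistribution B := by
  ext φ
  rw [indicatorDistribution_apply hA, indicatorDistribution_apply (hA.congr h)]
  refine integral_congr_ae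
    ((indicator_ae_eq_of_ae_eq_set (f := (1 : Plane → ℝ)) h).mono fun p hp => ?_)
  simp only [hp]

lemma PlaneTest.integrable (φ : PlaneTest) : Integrable φ (volume : Measure Plane) :=
  φ.continuous.integrable_of_hasCompactSupport φ.hasCompactSupport

lemma PlaneTest.integrable_mul_indicator (φ : PlaneTest) {A : Set Plane}
    (hA : NullMeasurableSet A volume) :
    Integrable (fun p => φ p * A.indicator 1 p) (volume : Measure Plane) := by
  have : (fun p => φ p * A.indicator (1 : Plane → ℝ) p) = A.indicator φ := by
    ext p; by_cases hp : p ∈ A <;> simp [hp]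
  rw [this]
  exact (PlaneTest.integrable φ).indicator₀ hA

lemma indicatorDistribution_union {A B : Set Plane} (hA : NullMeasurableSet A volume)
    (hB : NullMeasurableSet B volume) (h : Disjoint A B) :
    indicatorDistribution (A ∪ B) = indicatorDistribution A + indicatorDistribution B := by
  ext φ
  have : (indicatorDistribution A + indicatorDistribution B) φ =
    indicatorDistribution A φ + indicatorDistribution B φ := rfl
  rw [this, indicatorDistribution_apply hA, indicatorDistribution_apply hB,
    indicatorDistribution_apply (hA.union hB), ← integral_add
    (PlaneTest.integrable_mul_indicator φ hA) (PlaneTest.integrable_mul_indicator φ hB)]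
  refine integral_congr_ae (Eventually.of_forall fun p => ?_)
  simp only [indicator_union_of_disjoint h]
  ring

lemma D₁_apply (f : PlaneDistribution) (φ : PlaneTest) :
    D₁ f φ = - f (∂_{((1, 0) : Plane)} φ) := by
  rw [D₁, Distribution.lineDerivOp_apply_apply, map_neg]

lemma D₂_apply (f : PlaneDistribution) (φ : PlaneTest) :
    D₂ f φ = - f (∂_{((0, 1) : Plane)} φ) := by
  rw [D₂, Distribution.lineDerivOp_apply_apply, map_neg]

lemma DD_apply (f : PlaneDistribution) (φ : PlaneTest) :
    DD f φ = f (∂_{((0, 1) : Plane)} (∂_{((1, 0) : Plane)} φ)) := by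
  rw [DD, D₁_apply, D₂_apply, neg_neg]

lemma D₁_add (f g : PlaneDistribution) : D₁ (f + g) = D₁ f + D₁ g := by
  rw [D₁, LineDeriv.lineDerivOp_add]; rfl

lemma D₂_add (f g : PlaneDistribution) : D₂ (f + g) = D₂ f + D₂ g := by
  rw [D₂, LineDeriv.lineDerivOp_add]; rfl

lemma DD_add (f g : PlaneDistribution) : DD (f + g) = DD f + DD g := by
  rw [DD, D₂_add, D₁_add]; rfl

/-! ### The distribution function of a signed measure -/

/-- The distribution function `(x, y) ↦ m ((-∞, x] × (-∞, y])`. -/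
noncomputable def cdf (m : SignedMeasure Plane) (p : Plane) : ℝ := m (Iic p.1 ×ˢ Iic p.2)

lemma measurableSet_le_pairs :
    MeasurableSet {q : Plane × Plane | q.2.1 ≤ q.1.1 ∧ q.2.2 ≤ q.1.2} :=
  (measurableSet_le measurable_snd.fst measurable_fst.fst).inter
    (measurableSet_le measurable_snd.snd measurable_fst.snd)

lemma measurable_real_lowerQuadrant (μ : Measure Plane) [IsFiniteMeasure μ] :
    Measurable fun p : Plane => μ.real (Iic p.1 ×ˢ Iic p.2) := by
  have h := measurable_measure_prodMk_left (ν := μ) measurableSet_le_pairs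
  exact h.ennreal_toReal

lemma cdf_eq (m : SignedMeasure Plane) (p : Plane) :
    cdf m p = m.toJordanDecomposition.posPart.real (Iic p.1 ×ˢ Iic p.2) -
      m.toJordanDecomposition.negPart.real (Iic p.1 ×ˢ Iic p.2) :=
  m.apply_eq_posPart_real_sub_negPart_real (measurableSet_Iic.prod measurableSet_Iic)

lemma measurable_cdf (m : SignedMeasure Plane) : Measurable (cdf m) := by
  have : cdf m = fun p => _ := funext (cdf_eq m)
  rw [this]
  exact (measurable_real_lowerQuadrant _).sub (measurable_real_lowerQuadrant _)

lemma norm_cdf_le (m : SignedMeasure Plane) (p : Plane) : ‖cdf m p‖ ≤ m.variation.real univ :=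
  (VectorMeasure.norm_measure_le_variation (measure_ne_top _ _)).trans
    (measureReal_mono (subset_univ _))

lemma vectorIntegral_eq_sub (m : SignedMeasure Plane) (φ : PlaneTest) :
    ∫ᵛ p, φ p ∂•m = (∫ p, φ p ∂m.toJordanDecomposition.posPart) -
      ∫ p, φ p ∂m.toJordanDecomposition.negPart := by
  have hB : ContinuousLinearMap.lsmul ℝ ℝ = (ContinuousLinearMap.lsmul ℝ ℝ (E := ℝ)).flip := by
    ext; simp
  conv_lhs => rw [← m.toSignedMeasure_toJordanDecomposition]
  rw [JordanDecomposition.toSignedMeasure, VectorMeasure.integral_sub_vectorMeasure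
    (PlaneTest.integrable_vectorMeasure _ _) (PlaneTest.integrable_vectorMeasure _ _), hB,
    VectorMeasure.integral_toSignedMeasure, VectorMeasure.integral_toSignedMeasure]

lemma integral_Ici_deriv (α : LineTest) (s : ℝ) : ∫ x in Ici s, deriv α x = - α s := by
  rw [integral_Ici_eq_integral_Ioi]
  exact α.hasCompactSupport.integral_Ioi_deriv_eq (α.contDiff.of_le (by simp)) s

/-- Fubini: `w` lies in the lower quadrant of `z` iff `z` lies in the upper quadrant of `w`, and
over the latter the product of derivatives integrates to `α w.1 * β w.2`, the two minus signs
cancelling. -/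
lemma integral_derivTest_mul_lowerQuadrant (μ : Measure Plane) [IsFiniteMeasure μ]
    (α β : LineTest) :
    ∫ p : Plane, tensor (derivTest α) (derivTest β) p * μ.real (Iic p.1 ×ˢ Iic p.2) =
      ∫ w, tensor α β w ∂μ := by
  set T := tensor (derivTest α) (derivTest β)
  set R : Set (Plane × Plane) := {q | q.2.1 ≤ q.1.1 ∧ q.2.2 ≤ q.1.2}
  let F : Plane → Plane → ℝ := fun z w => R.indicator (fun q => T q.1) (z, w)
  have hint : Integrable (Function.uncurry F) ((volume : Measure Plane).prod μ) := by
    have : Function.uncurry F = R.indicator (fun q => T q.1) := rfl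
    rw [this]
    exact ((PlaneTest.integrable T).comp_fst μ).indicator measurableSet_le_pairs
  have h1 : ∀ z : Plane, T z * μ.real (Iic z.1 ×ˢ Iic z.2) = ∫ w, F z w ∂μ := by
    intro z
    have : F z = (Iic z.1 ×ˢ Iic z.2).indicator fun _ => T z := rfl
    rw [this, integral_indicator_const _ (measurableSet_Iic.prod measurableSet_Iic), smul_eq_mul,
      mul_comm]
  have h2 : ∀ w : Plane, ∫ z, F z w = tensor α β w := by
    intro w
    have : (fun z => F z w) = fun z : Plane =>
        (Ici w.1).indicator (deriv α) z.1 * (Ici w.2).indicator (deriv β) z.2 := by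
      ext z
      by_cases hx : w.1 ≤ z.1 <;> by_cases hy : w.2 ≤ z.2 <;> simp [F, R, T, indicator, hx, hy]
    rw [this, Measure.volume_eq_prod, integral_prod_mul, integral_indicator measurableSet_Ici,
      integral_indicator measurableSet_Ici, integral_Ici_deriv, integral_Ici_deriv]
    simp
  calc _ = ∫ z, ∫ w, F z w ∂μ := integral_congr_ae (Eventually.of_forall h1)
    _ = ∫ w, (∫ z, F z w) ∂μ := integral_integral_swap hint
    _ = _ := by simp_rw [h2]

lemma integral_derivTest_mul_cdf (m : SignedMeasure Plane) (α β : LineTest) :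
    ∫ p : Plane, tensor (derivTest α) (derivTest β) p * cdf m p = ∫ᵛ w, tensor α β w ∂•m := by
  have hi : ∀ μ : Measure Plane, IsFiniteMeasure μ → Integrable (fun p : Plane =>
      tensor (derivTest α) (derivTest β) p * μ.real (Iic p.1 ×ˢ Iic p.2)) := by
    intro μ _
    refine (PlaneTest.integrable _).mul_bdd (c := μ.real univ)
      (measurable_real_lowerQuadrant μ).aestronglyMeasurable (Eventually.of_forall fun p => ?_)
    rw [Real.norm_of_nonneg measureReal_nonneg]
    exact measureReal_mono (subset_univ _)
  simp_rw [vectorIntegral_eq_sub, cdf_eq, mul_sub]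
  rw [integral_sub (hi _ inferInstance) (hi _ inferInstance), integral_derivTest_mul_lowerQuadrant,
    integral_derivTest_mul_lowerQuadrant]

/-! ### The indicator as the distribution function of its mixed derivative -/

/-- Every test function is on the half-line `[0, ∞)` the derivative of a test function. -/
lemma exists_derivTest_eq (a : LineTest) : ∃ α : LineTest, ∀ x, 0 ≤ x → derivTest α x = a x := by
  obtain ⟨R, hR⟩ := a.hasCompactSupport.isCompact.bddAbove
  have ha : ∀ x, R < x → a x = 0 := fun x hx =>
    image_eq_zero_of_notMem_tsupport fun h => (hR h).not_gt hx
  -- The primitive based at `R`, to the right of the support, vanishes on `[R, ∞)`. On the left it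
  -- may tend to a nonzero constant, so a cutoff is needed there.
  let P : ℝ → ℝ := fun x => ∫ t in R..x, a t
  have hP : ∀ x, HasDerivAt P (a x) x := fun x =>
    intervalIntegral.integral_hasDerivAt_right (a.continuous.intervalIntegrable _ _)
      (a.continuous.stronglyMeasurableAtFilter _ _) a.continuous.continuousAt
  have hPd : deriv P = a := funext fun x => (hP x).deriv
  have hPs : ContDiff ℝ (⊤ : ℕ∞) P := by
    rw [contDiff_infty_iff_deriv, hPd]
    exact ⟨fun x => (hP x).differentiableAt, a.contDiff⟩
  have hPz : ∀ x, R ≤ x → P x = 0 := by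
    intro x hx
    refine (intervalIntegral.integral_congr_ae (g := fun _ => 0) ?_).trans (by simp)
    refine Eventually.of_forall fun t ht => ha t ?_
    rw [uIoc_of_le hx] at ht
    exact ht.1
  -- The cutoff is 0 for `x ≤ -1` and 1 for `x ≥ -1/2`, hence 1 on a neighbourhood of every point of
  -- `[0, ∞)`.
  let χ : ℝ → ℝ := fun x => Real.smoothTransition (2 * x + 2)
  have hχ : ContDiff ℝ (⊤ : ℕ∞) χ := Real.smoothTransition.contDiff.comp (by fun_prop)
  refine ⟨⟨fun x => χ x * P x, hχ.mul hPs, ?_, fun _ _ => trivial⟩, fun x hx => ?_⟩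
  · refine HasCompactSupport.intro (isCompact_Icc (a := -1) (b := R)) fun x hx => ?_
    by_cases h : -1 ≤ x
    · rw [hPz x (not_lt.1 fun h' => hx ⟨h, h'.le⟩), mul_zero]
    · rw [show χ x = 0 from Real.smoothTransition.zero_of_nonpos (by linarith), zero_mul]
  · rw [derivTest_apply]
    change deriv (fun x => χ x * P x) x = a x
    rw [← hPd]
    refine Filter.EventuallyEq.deriv_eq ?_
    filter_upwards [lt_mem_nhds (show (-1 / 2 : ℝ) < x by linarith)] with y hy
    rw [show χ y = 1 from Real.smoothTransition.one_of_one_le (by linarith), one_mul]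

/-- The signed measure with density `h` vanishes on boxes, hence identically. -/
lemma ae_eq_zero_of_integral_boxes {h : Plane → ℝ} (hi : Integrable h)
    (h0 : ∫ p, h p = 0) (hb : ∀ a b c d : ℝ, ∫ p in Ioo a b ×ˢ Ioo c d, h p = 0) :
    h =ᵐ[volume] 0 := by
  have hm : (volume : Measure Plane).withDensityᵥ h = 0 := by
    refine signedMeasure_eq_zero_of_boxes _ ?_ ?_
    · rw [withDensityᵥ_apply hi .univ, setIntegral_univ, h0]
    · intro a b c d
      rw [withDensityᵥ_apply hi (measurableSet_Ioo.prod measurableSet_Ioo), hb]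
  refine hi.ae_eq_zero_of_forall_setIntegral_eq_zero fun s hs _ => ?_
  rw [← withDensityᵥ_apply hi hs, hm]
  rfl

/-- A bounded measurable function orthogonal to all product test functions vanishes almost
everywhere. -/
lemma ae_eq_zero_of_integral_tensor {h : Plane → ℝ} (hm : AEStronglyMeasurable h volume) {C : ℝ}
    (hC : ∀ p, ‖h p‖ ≤ C) (h0 : ∀ a b : LineTest, ∫ p, tensor a b p * h p = 0) :
    h =ᵐ[volume] 0 := by
  have hbox : ∀ a b c d : ℝ, IntegrableOn h (Ioo a b ×ˢ Ioo c d) := by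
    intro a b c d
    refine Measure.integrableOn_of_bounded (M := C) ?_ hm (Eventually.of_forall hC)
    rw [Measure.volume_eq_prod, Measure.prod_prod]
    simp [ENNReal.mul_eq_top]
  have hb : ∀ a b c d : ℝ, ∫ p in Ioo a b ×ˢ Ioo c d, h p = 0 := by
    intro a b c d
    have hU : MeasurableSet (Ioo a b ×ˢ Ioo c d) := measurableSet_Ioo.prod measurableSet_Ioo
    have lim : Tendsto (fun n => ∫ p, tensor (bump a b n) (bump c d n) p * h p) atTop
        (𝓝 (∫ p, (Ioo a b ×ˢ Ioo c d).indicator 1 p * h p)) := by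
      refine tendsto_integral_of_dominated_convergence
        (fun p => (Ioo a b ×ˢ Ioo c d).indicator (fun p => ‖h p‖) p)
        (fun n => (tensor _ _).continuous.aestronglyMeasurable.mul hm)
        ((integrable_indicator_iff hU).2 (Integrable.norm (hbox a b c d)))
        (fun n => Eventually.of_forall fun p => ?_)
        (Eventually.of_forall fun p => (tendsto_tensor_bump a b c d p).mul_const _)
      by_cases hp : p ∈ Ioo a b ×ˢ Ioo c d
      · rw [indicator_of_mem hp, norm_mul]
        exact mul_le_of_le_one_left (norm_nonneg _) (abs_tensor_bump_le a b c d n p)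
      · rw [indicator_of_notMem hp, tensor_apply]
        have : bump a b n p.1 * bump c d n p.2 = 0 := by
          by_cases h1 : p.1 ∈ Ioo a b
          · rw [bump_eq_zero n (fun h2 => hp ⟨h1, h2⟩), mul_zero]
          · rw [bump_eq_zero n h1, zero_mul]
        simp [this]
    have e : ∀ p, (Ioo a b ×ˢ Ioo c d).indicator (1 : Plane → ℝ) p * h p =
        (Ioo a b ×ˢ Ioo c d).indicator h p := by
      intro p
      by_cases hp : p ∈ Ioo a b ×ˢ Ioo c d
      · rw [indicator_of_mem hp, indicator_of_mem hp, Pi.one_apply, one_mul]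
      · rw [indicator_of_notMem hp, indicator_of_notMem hp, zero_mul]
    simp_rw [e, integral_indicator hU, h0] at lim
    exact tendsto_nhds_unique lim tendsto_const_nhds
  -- A bounded `h` need not be integrable, so it is truncated to an exhausting sequence of boxes.
  have hN : ∀ n : ℕ, (Ioo (-n : ℝ) n ×ˢ Ioo (-n : ℝ) n).indicator h =ᵐ[volume] 0 := by
    intro n
    have hU : MeasurableSet (Ioo (-n : ℝ) n ×ˢ Ioo (-n : ℝ) n) :=
      measurableSet_Ioo.prod measurableSet_Ioo
    refine ae_eq_zero_of_integral_boxes ((hbox _ _ _ _).integrable_indicator hU) ?_ ?_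
    · rw [integral_indicator hU, hb]
    · intro a b c d
      rw [setIntegral_indicator hU, prod_inter_prod, Ioo_inter_Ioo, Ioo_inter_Ioo, hb]
  filter_upwards [ae_all_iff.2 hN] with p hp
  obtain ⟨n, hn⟩ := exists_nat_gt (max |p.1| |p.2|)
  have := hp n
  rwa [indicator_of_mem] at this
  exact ⟨abs_lt.1 ((le_max_left _ _).trans_lt hn), abs_lt.1 ((le_max_right _ _).trans_lt hn)⟩

lemma apply_eq_zero_of_disjoint {m : SignedMeasure Plane} {K : Set Plane}
    (hm : m.variation Kᶜ = 0) {s : Set Plane} (hs : Disjoint s K) : m s = 0 := by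
  rw [← enorm_eq_zero, ← nonpos_iff_eq_zero, ← hm]
  exact (VectorMeasure.enorm_measure_le_variation m s).trans
    (measure_mono hs.subset_compl_right)

/-- The indicator function of an admissible set is the distribution function of its mixed
derivative. -/
lemma indicator_ae_eq_cdf {L : ℝ} {A : Set Plane} (hA : NullMeasurableSet A volume)
    (hAK : A ⊆ square L) {m : SignedMeasure Plane} (hm : m.variation (square L)ᶜ = 0)
    (h : IsGivenBy (DD (indicatorDistribution A)) m) :
    A.indicator 1 =ᵐ[volume] cdf m := by
  have hd : (fun p => A.indicator 1 p - cdf m p) =ᵐ[volume] 0 := by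
    refine ae_eq_zero_of_integral_tensor (C := 1 + m.variation.real univ)
      ((aestronglyMeasurable_const (b := (1 : ℝ))).indicator₀ hA |>.sub
        (measurable_cdf m).aestronglyMeasurable) ?_ ?_
    · intro p
      refine (norm_sub_le _ _).trans (add_le_add ?_ (norm_cdf_le m p))
      exact (norm_indicator_le_norm_self _ _).trans (by simp)
    · intro a b
      obtain ⟨α, hα⟩ := exists_derivTest_eq a
      obtain ⟨β, hβ⟩ := exists_derivTest_eq b
      have h1 : ∫ p, tensor (derivTest α) (derivTest β) p * (A.indicator 1 p - cdf m p) = 0 := by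
        simp_rw [mul_sub]
        rw [integral_sub (PlaneTest.integrable_mul_indicator _ hA)
          ((PlaneTest.integrable _).mul_bdd (c := m.variation.real univ)
            (measurable_cdf m).aestronglyMeasurable (Eventually.of_forall (norm_cdf_le m))),
          integral_derivTest_mul_cdf, ← h, DD_apply, indicatorDistribution_apply hA,
          lineDeriv_fst_tensor, lineDeriv_snd_tensor, sub_self]
      rw [← h1]
      refine integral_congr_ae (Eventually.of_forall fun p => ?_)
      -- The functions `a`, `b` are derivatives of test functions only on `[0, ∞)`. This suffices,
      -- since off the first quadrant both the indicator and `cdf m` vanish.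
      by_cases hp : 0 ≤ p.1 ∧ 0 ≤ p.2
      · simp only [tensor_apply, hα _ hp.1, hβ _ hp.2]
      · have hpA : p ∉ A := fun hpA => hp ⟨(hAK hpA).1.1, (hAK hpA).2.1⟩
        have hc : cdf m p = 0 := by
          refine apply_eq_zero_of_disjoint hm (Set.disjoint_left.2 fun w hw hwK => hp ?_)
          exact ⟨hwK.1.1.trans hw.1, hwK.2.1.trans hw.2⟩
        simp [hpA, hc]
  filter_upwards [hd] with p hp
  exact sub_eq_zero.1 hp

/-- The signed measure `m`, supported in the square, is the mixed derivative of the indicator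
function of `A`. -/
structure IsCornerMeasure (L : ℝ) (A : Set Plane) (m : SignedMeasure Plane) : Prop where
  subset : A ⊆ square L
  nullMeasurable : NullMeasurableSet A volume
  support : m.variation (square L)ᶜ = 0
  isGivenBy : IsGivenBy (DD (indicatorDistribution A)) m

lemma IsAdmissible.exists_isCornerMeasure {L : ℝ} {A : Set Plane}
    (h : IsAdmissible (square L) A) : ∃ m, IsCornerMeasure L A m := by
  obtain ⟨⟨m, hm, hg⟩, -⟩ := h.mem
  exact ⟨m, h.subset, h.nullMeasurable, by rwa [← SignedMeasure.totalVariation_eq_variation], hg⟩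

lemma IsCornerMeasure.isAdmissible {L : ℝ} {A : Set Plane} {m : SignedMeasure Plane}
    (h : IsCornerMeasure L A m) : IsAdmissible (square L) A where
  subset := h.subset
  nullMeasurable := h.nullMeasurable
  mem := by
    refine ⟨⟨m, by rw [SignedMeasure.totalVariation_eq_variation]; exact h.support, h.isGivenBy⟩,
      fun φ hφ => ?_⟩
    rw [indicatorDistribution_apply h.nullMeasurable]
    refine integral_eq_zero_of_ae (Eventually.of_forall fun p => ?_)
    by_cases hp : p ∈ A
    · have : φ p = 0 := image_eq_zero_of_notMem_tsupport fun h' => hφ h' (h.subset hp)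
      simp [this]
    · simp [hp]

lemma IsCornerMeasure.union {L : ℝ} {A B : Set Plane} {m m' : SignedMeasure Plane}
    (h : IsCornerMeasure L A m) (h' : IsCornerMeasure L B m') (hd : Disjoint A B) :
    IsCornerMeasure L (A ∪ B) (m + m') where
  subset := union_subset h.subset h'.subset
  nullMeasurable := h.nullMeasurable.union h'.nullMeasurable
  support := by
    have := VectorMeasure.variation_add_le (μ := m) (ν := m') (square L)ᶜ
    rw [Measure.add_apply, h.support, h'.support, add_zero] at this
    exact le_antisymm this zero_le
  isGivenBy := by
    rw [indicatorDistribution_union h.nullMeasurable h'.nullMeasurable hd, DD_add]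
    exact h.isGivenBy.add h'.isGivenBy

lemma IsCornerMeasure.ae_eq {L : ℝ} {A : Set Plane} {m : SignedMeasure Plane}
    (h : IsCornerMeasure L A m) : A.indicator 1 =ᵐ[volume] cdf m :=
  indicator_ae_eq_cdf h.nullMeasurable h.subset h.support h.isGivenBy

/-! ### The mixed derivative of an indicator function is integer valued -/

/-- For points approaching `p` from the upper right, the indicators of the closed lower quadrants
converge pointwise; dominated convergence applies. -/
lemma tendsto_cdf (m : SignedMeasure Plane) {z : ℕ → Plane} {p : Plane}
    (hz : Tendsto z atTop (𝓝 p)) (hp : ∀ n, p ≤ z n) :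
    Tendsto (fun n => cdf m (z n)) atTop (𝓝 (cdf m p)) := by
  have hI : ∀ q : Plane, MeasurableSet (Iic q.1 ×ˢ Iic q.2) := fun q =>
    measurableSet_Iic.prod measurableSet_Iic
  have e : ∀ q, cdf m q = ∫ᵛ w, (Iic q.1 ×ˢ Iic q.2).indicator (1 : Plane → ℝ) w ∂•m := fun q =>
    (vectorIntegral_indicator_one m (hI q)).symm
  simp_rw [e]
  refine VectorMeasure.tendsto_integral_filter_of_norm_le_const
    (Eventually.of_forall fun n => ((measurable_one.indicator (hI _))).aestronglyMeasurable)
    ⟨1, Eventually.of_forall fun n => Eventually.of_forall fun w => ?_⟩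
    (Eventually.of_forall fun w => ?_)
  · exact (norm_indicator_le_norm_self _ _).trans (by simp)
  · have h1 : ∀ᶠ n in atTop, (w.1 ≤ (z n).1 ↔ w.1 ≤ p.1) := by
      by_cases h : w.1 ≤ p.1
      · exact Eventually.of_forall fun n => iff_of_true (h.trans (hp n).1) h
      · filter_upwards [((continuous_fst.tendsto p).comp hz).eventually_lt_const (not_le.1 h)]
          with n hn using iff_of_false (not_le.2 hn) h
    have h2 : ∀ᶠ n in atTop, (w.2 ≤ (z n).2 ↔ w.2 ≤ p.2) := by
      by_cases h : w.2 ≤ p.2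
      · exact Eventually.of_forall fun n => iff_of_true (h.trans (hp n).2) h
      · filter_upwards [((continuous_snd.tendsto p).comp hz).eventually_lt_const (not_le.1 h)]
          with n hn using iff_of_false (not_le.2 hn) h
    refine tendsto_const_nhds.congr' ?_
    filter_upwards [h1, h2] with n h1 h2
    have : w ∈ Iic (z n).1 ×ˢ Iic (z n).2 ↔ w ∈ Iic p.1 ×ˢ Iic p.2 := and_congr h1 h2
    by_cases hw : w ∈ Iic p.1 ×ˢ Iic p.2
    · rw [indicator_of_mem hw, indicator_of_mem (this.2 hw)]
    · rw [indicator_of_notMem hw, indicator_of_notMem (mt this.1 hw)]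

lemma exists_mem_of_ae {P : Plane → Prop} (h : ∀ᵐ z, P z) {U : Set Plane} (hU : IsOpen U)
    (hne : U.Nonempty) : ∃ z ∈ U, P z :=
  (Measure.dense_of_ae h).inter_open_nonempty U hU hne

/-- The almost everywhere identity becomes a statement about every point: `p` is a limit from the
upper right of points where `cdf m` equals the indicator, and `{0, 1}` is closed. -/
lemma IsCornerMeasure.cdf_mem {L : ℝ} {A : Set Plane} {m : SignedMeasure Plane}
    (h : IsCornerMeasure L A m) (p : Plane) : cdf m p ∈ ({0, 1} : Set ℝ) := by
  have hpos : ∀ n : ℕ, (0 : ℝ) < 1 / (n + 1) := fun n => Nat.one_div_pos_of_nat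
  have key : ∀ n : ℕ, ∃ z : Plane, (p ≤ z ∧ z ≤ p + (1 / ((n : ℝ) + 1), 1 / ((n : ℝ) + 1))) ∧
      A.indicator 1 z = cdf m z := by
    intro n
    obtain ⟨z, hz, he⟩ := exists_mem_of_ae h.ae_eq
      (U := Ioo p.1 (p.1 + 1 / (n + 1)) ×ˢ Ioo p.2 (p.2 + 1 / (n + 1)))
      (isOpen_Ioo.prod isOpen_Ioo)
      ((nonempty_Ioo.2 (by linarith [hpos n])).prod (nonempty_Ioo.2 (by linarith [hpos n])))
    exact ⟨z, ⟨⟨hz.1.1.le, hz.2.1.le⟩, ⟨hz.1.2.le, hz.2.2.le⟩⟩, he⟩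
  choose z hz he using key
  have hlim : Tendsto z atTop (𝓝 p) := by
    have h0 : ∀ x : ℝ, Tendsto (fun n : ℕ => x + 1 / ((n : ℝ) + 1)) atTop (𝓝 x) := fun x => by
      simpa using (tendsto_const_nhds (x := x)).add
        (tendsto_one_div_add_atTop_nhds_zero_nat (𝕜 := ℝ))
    exact (Prod.tendsto_iff z p).2 ⟨tendsto_of_tendsto_of_tendsto_of_le_of_le tendsto_const_nhds
      (h0 p.1) (fun n => (hz n).1.1) (fun n => (hz n).2.1),
      tendsto_of_tendsto_of_tendsto_of_le_of_le tendsto_const_nhds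
      (h0 p.2) (fun n => (hz n).1.2) (fun n => (hz n).2.2)⟩
  refine IsClosed.mem_of_tendsto (Set.Finite.isClosed (toFinite _))
    (tendsto_cdf m hlim fun n => (hz n).1) (Eventually.of_forall fun n => ?_)
  rw [← he]
  by_cases hA : z n ∈ A <;> simp [hA]

lemma isCountablySpanning_range_Iic : IsCountablySpanning (range (Iic : ℝ → Set ℝ)) := by
  refine ⟨fun n : ℕ => Iic (n : ℝ), fun n => ⟨n, rfl⟩, eq_univ_of_forall fun x => ?_⟩
  obtain ⟨n, hn⟩ := exists_nat_ge x
  exact mem_iUnion.2 ⟨n, hn⟩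

/-- Dynkin induction from the closed lower quadrants, where `m` is 0 or 1. Countable unions pass
because the integers are closed in `ℝ`. -/
lemma IsCornerMeasure.exists_int {L : ℝ} {A : Set Plane} {m : SignedMeasure Plane}
    (h : IsCornerMeasure L A m) {E : Set Plane} (hE : MeasurableSet E) :
    m E ∈ range ((↑) : ℤ → ℝ) := by
  have hc : ∀ p, cdf m p ∈ range ((↑) : ℤ → ℝ) := by
    intro p
    rcases h.cdf_mem p with h | h
    · exact ⟨0, by simp [h]⟩
    · exact ⟨1, by simpa using h.symm⟩
  -- Complements require the total mass to be an integer; as `m` lives on the square, that mass is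
  -- itself a value of `cdf m`.
  have huniv : m univ = cdf m (L, L) := by
    have hI : MeasurableSet (Iic L ×ˢ Iic L) := measurableSet_Iic.prod measurableSet_Iic
    have h0 : m (Iic L ×ˢ Iic L)ᶜ = 0 := apply_eq_zero_of_disjoint h.support
      (Set.disjoint_left.2 fun w hw hwK => hw ⟨hwK.1.2, hwK.2.2⟩)
    rw [← union_compl_self (Iic L ×ˢ Iic L), VectorMeasure.of_union disjoint_compl_right hI
      hI.compl, h0, add_zero]
    rfl
  have hgen : (Prod.instMeasurableSpace : MeasurableSpace Plane) =
      MeasurableSpace.generateFrom (image2 (· ×ˢ ·) (range (Iic : ℝ → Set ℝ)) (range Iic)) :=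
    (generateFrom_eq_prod (borel_eq_generateFrom_Iic ℝ).symm (borel_eq_generateFrom_Iic ℝ).symm
      isCountablySpanning_range_Iic isCountablySpanning_range_Iic).symm
  induction E, hE using MeasurableSpace.induction_on_inter hgen
    (isPiSystem_Iic.prod isPiSystem_Iic) with
  | empty => exact ⟨0, by simp⟩
  | basic t ht =>
    obtain ⟨_, ⟨x, rfl⟩, _, ⟨y, rfl⟩, rfl⟩ := ht
    exact hc (x, y)
  | compl t ht ih =>
    obtain ⟨k, hk⟩ := ih
    obtain ⟨l, hl⟩ := hc (L, L)
    refine ⟨l - k, ?_⟩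
    rw [VectorMeasure.of_compl ht, huniv, ← hk, ← hl]
    push_cast; ring
  | iUnion f hfd hfm ih =>
    have hs := m.m_iUnion hfm hfd
    refine Int.isClosedEmbedding_coe_real.isClosed_range.mem_of_tendsto hs
      (Eventually.of_forall fun s => ?_)
    choose k hk using ih
    exact ⟨∑ i ∈ s, k i, by push_cast; exact Finset.sum_congr rfl fun i _ => hk i⟩

/-! ### The mixed derivative of an indicator function is supported in a finite set -/

/-- The punctured balls shrink to the empty set, so the finite measure `m.variation` tends to 0
along them. -/
lemma exists_ball_variation_lt_one (m : SignedMeasure Plane) (p : Plane) :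
    ∃ r > 0, m.variation (Metric.ball p r \ {p}) < 1 := by
  have hanti : Antitone fun n : ℕ => Metric.ball p (1 / ((n : ℝ) + 1)) \ {p} := fun i j hij =>
    sdiff_subset_sdiff_left (Metric.ball_subset_ball (Nat.one_div_le_one_div hij))
  have hempty : ⋂ n : ℕ, Metric.ball p (1 / ((n : ℝ) + 1)) \ {p} = ∅ := by
    refine eq_empty_of_forall_notMem fun q hq => ?_
    have hq' := fun n => mem_iInter.1 hq n
    obtain ⟨n, hn⟩ := exists_nat_one_div_lt (dist_pos.2 (hq' 0).2)
    exact (lt_asymm hn) (hq' n).1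
  have lim := tendsto_measure_iInter_atTop (μ := m.variation)
    (s := fun n : ℕ => Metric.ball p (1 / ((n : ℝ) + 1)) \ {p})
    (fun n => (Metric.isOpen_ball.measurableSet.diff (measurableSet_singleton p)).nullMeasurableSet)
    hanti ⟨0, measure_ne_top _ _⟩
  rw [hempty, measure_empty] at lim
  obtain ⟨n, hn⟩ := (lim.eventually_lt_const zero_lt_one).exists
  exact ⟨1 / ((n : ℝ) + 1), Nat.one_div_pos_of_nat, hn⟩

/-- An integer of absolute value less than 1 is 0, so `m` vanishes on a small punctured ball about
each point. Finitely many of these balls cover the compact square, and their centres carry `m`. -/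
lemma IsCornerMeasure.exists_finite {L : ℝ} {A : Set Plane} {m : SignedMeasure Plane}
    (h : IsCornerMeasure L A m) : ∃ S : Finset Plane, m.variation (S : Set Plane)ᶜ = 0 := by
  choose r hr hlt using exists_ball_variation_lt_one m
  have h0 : ∀ p, m.variation (Metric.ball p (r p) \ {p}) = 0 := by
    intro p
    rw [VectorMeasure.variation_apply_eq_zero
      (Metric.isOpen_ball.measurableSet.diff (measurableSet_singleton p))]
    intro t ht htm
    obtain ⟨k, hk⟩ := h.exists_int htm
    have h1 : ‖m t‖ₑ < 1 := (VectorMeasure.enorm_measure_le_variation m t).trans_lt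
      ((measure_mono ht).trans_lt (hlt p))
    rw [← ofReal_norm, ← ENNReal.ofReal_one, ENNReal.ofReal_lt_ofReal_iff one_pos, ← hk,
      Real.norm_eq_abs] at h1
    have h2 : |k| < 1 := by exact_mod_cast h1
    rw [← hk, Int.abs_lt_one_iff.1 h2, Int.cast_zero]
  obtain ⟨S, -, hS⟩ := (isCompact_Icc.prod isCompact_Icc : IsCompact (square L)).elim_nhds_subcover
    (fun p => Metric.ball p (r p)) fun p _ => Metric.ball_mem_nhds p (hr p)
  refine ⟨S, measure_mono_null (t := (square L)ᶜ ∪ ⋃ p ∈ S, Metric.ball p (r p) \ {p}) ?_ ?_⟩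
  · intro q hq
    by_cases hK : q ∈ square L
    · obtain ⟨p, hp, hqp⟩ := mem_iUnion₂.1 (hS hK)
      refine Or.inr (mem_iUnion₂.2 ⟨p, hp, hqp, ?_⟩)
      rintro rfl
      exact hq hp
    · exact Or.inl hK
  · exact measure_union_null h.support ((measure_biUnion_null_iff S.countable_toSet).2
      fun p _ => h0 p)

/-! ### Quadrants -/

/-- The closed or the open lower half-line with endpoint `x`. -/
def lower : Bool → ℝ → Set ℝ
  | true, x => Iic x
  | false, x => Iio x

/-- The half-open upper or the open lower half-line with endpoint `x`. -/
def side : Bool → ℝ → Set ℝ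
  | true, x => Ici x
  | false, x => Iio x

/-- The four values near `p` of the distribution function of a finitely supported signed
measure. -/
noncomputable def corner (m : SignedMeasure Plane) (p : Plane) (b c : Bool) : ℝ :=
  m (lower b p.1 ×ˢ lower c p.2)

lemma measurableSet_lower (b : Bool) (x : ℝ) : MeasurableSet (lower b x) := by
  cases b
  exacts [measurableSet_Iio, measurableSet_Iic]

lemma corner_add (m m' : SignedMeasure Plane) (p : Plane) (b c : Bool) :
    corner (m + m') p b c = corner m p b c + corner m' p b c := rfl

lemma corner_sub_corner (m : SignedMeasure Plane) (p : Plane) (c : Bool) :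
    corner m p true c - corner m p false c = m ({p.1} ×ˢ lower c p.2) := by
  have : lower true p.1 = lower false p.1 ∪ {p.1} := Iio_union_right.symm
  rw [corner, this, union_prod, VectorMeasure.of_union, corner, add_sub_cancel_left]
  · exact Set.disjoint_left.2 fun w hw hw' => hw.1.ne hw'.1
  · exact (measurableSet_lower _ _).prod (measurableSet_lower _ _)
  · exact (measurableSet_singleton _).prod (measurableSet_lower _ _)

lemma apply_singleton (m : SignedMeasure Plane) (p : Plane) :
    m {p} = corner m p true true - corner m p false true -
      (corner m p true false - corner m p false false) := by
  rw [corner_sub_corner, corner_sub_corner]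
  have : lower true p.2 = lower false p.2 ∪ {p.2} := Iio_union_right.symm
  rw [this, prod_union, VectorMeasure.of_union, add_sub_cancel_left, singleton_prod_singleton]
  · exact Set.disjoint_left.2 fun w hw hw' => hw.2.ne hw'.2
  · exact (measurableSet_singleton _).prod (measurableSet_lower _ _)
  · exact (measurableSet_singleton _).prod (measurableSet_singleton _)

lemma apply_inter_of_variation_compl {m : SignedMeasure Plane} {S : Set Plane}
    (hS : MeasurableSet S) (h : m.variation Sᶜ = 0) {E : Set Plane} (hE : MeasurableSet E) :
    m E = m (E ∩ S) := by
  rw [← inter_union_sdiff E S, VectorMeasure.of_union disjoint_sdiff_inter.symm (hE.inter hS)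
    (hE.diff hS), inter_union_sdiff, add_eq_left]
  exact apply_eq_zero_of_disjoint h disjoint_sdiff_left

/-- Moving the endpoint `t` slightly away from `x` cannot cross a fixed `s ≠ x`; for `s = x` the
side on which `t` lies decides between the closed and the open half-line. -/
lemma eventually_le_iff_mem_lower (s x : ℝ) :
    ∀ᶠ t in 𝓝 x, ∀ b, t ∈ side b x → (s ≤ t ↔ s ∈ lower b x) := by
  rcases lt_trichotomy s x with h | rfl | h
  · filter_upwards [lt_mem_nhds h] with t ht b hb
    cases b
    · exact iff_of_true ht.le h
    · exact iff_of_true ht.le h.le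
  · refine Eventually.of_forall fun t b hb => ?_
    cases b
    · exact iff_of_false (not_le.2 hb) (lt_irrefl s)
    · exact iff_of_true hb (le_refl s)
  · filter_upwards [gt_mem_nhds h] with t ht b hb
    cases b
    · exact iff_of_false (not_le.2 ht) (lt_asymm h)
    · exact iff_of_false (not_le.2 ht) (not_le.2 h)

/-- The distribution function is constant near `p` in each of the four quadrants. -/
lemma eventually_cdf_eq_corner {m : SignedMeasure Plane} {S : Finset Plane}
    (hS : m.variation (S : Set Plane)ᶜ = 0) (p : Plane) :
    ∃ r > 0, ∀ z : Plane, |z.1 - p.1| < r → |z.2 - p.2| < r → ∀ b c,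
      z.1 ∈ side b p.1 → z.2 ∈ side c p.2 → cdf m z = corner m p b c := by
  have h1 : ∀ᶠ t in 𝓝 p.1, ∀ s ∈ S, ∀ b, t ∈ side b p.1 → (s.1 ≤ t ↔ s.1 ∈ lower b p.1) :=
    (Finset.eventually_all S).2 fun s _ => eventually_le_iff_mem_lower s.1 p.1
  have h2 : ∀ᶠ t in 𝓝 p.2, ∀ s ∈ S, ∀ b, t ∈ side b p.2 → (s.2 ≤ t ↔ s.2 ∈ lower b p.2) :=
    (Finset.eventually_all S).2 fun s _ => eventually_le_iff_mem_lower s.2 p.2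
  obtain ⟨r₁, hr₁, h1⟩ := Metric.eventually_nhds_iff.1 h1
  obtain ⟨r₂, hr₂, h2⟩ := Metric.eventually_nhds_iff.1 h2
  refine ⟨min r₁ r₂, lt_min hr₁ hr₂, fun z hz1 hz2 b c hb hc => ?_⟩
  have e1 := h1 (y := z.1) (hz1.trans_le (min_le_left _ _))
  have e2 := h2 (y := z.2) (hz2.trans_le (min_le_right _ _))
  rw [cdf, corner, apply_inter_of_variation_compl S.measurableSet hS
    (measurableSet_Iic.prod measurableSet_Iic), apply_inter_of_variation_compl S.measurableSet hS
    ((measurableSet_lower b p.1).prod (measurableSet_lower c p.2))]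
  congr 1
  ext s
  refine and_congr_left fun hs => and_congr (e1 s hs b hb) (e2 s hs c hc)

/-- The open interval of length `r` on one of the two sides of `x`. -/
def arm : Bool → ℝ → ℝ → Set ℝ
  | true, x, r => Ioo x (x + r)
  | false, x, r => Ioo (x - r) x

lemma isOpen_arm (b : Bool) (x r : ℝ) : IsOpen (arm b x r) := by
  cases b
  exacts [isOpen_Ioo, isOpen_Ioo]

lemma nonempty_arm (b : Bool) (x : ℝ) {r : ℝ} (hr : 0 < r) : (arm b x r).Nonempty := by
  cases b
  exacts [nonempty_Ioo.2 (by linarith), nonempty_Ioo.2 (by linarith)]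

lemma arm_subset_side (b : Bool) (x r : ℝ) : arm b x r ⊆ side b x := by
  cases b
  exacts [fun t ht => ht.2, fun t ht => ht.1.le]

lemma abs_sub_lt_of_mem_arm {b : Bool} {x r t : ℝ} (ht : t ∈ arm b x r) : |t - x| < r := by
  cases b
  · rw [abs_lt]; constructor <;> linarith [ht.1, ht.2]
  · rw [abs_lt]; constructor <;> linarith [ht.1, ht.2]

/-- Points of the quadrant `(b, c)` at `p`, arbitrarily near `p`, with a property that holds
almost everywhere. -/
lemma exists_mem_arm_of_ae {P : Plane → Prop} (h : ∀ᵐ z, P z) (p : Plane) (b c : Bool) {r : ℝ}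
    (hr : 0 < r) : ∃ z : Plane, z.1 ∈ arm b p.1 r ∧ z.2 ∈ arm c p.2 r ∧ P z := by
  obtain ⟨z, hz, hP⟩ := exists_mem_of_ae h ((isOpen_arm b p.1 r).prod (isOpen_arm c p.2 r))
    ((nonempty_arm b p.1 hr).prod (nonempty_arm c p.2 hr))
  exact ⟨z, hz.1, hz.2, hP⟩

lemma IsCornerMeasure.corner_mem {L : ℝ} {A : Set Plane} {m : SignedMeasure Plane}
    (h : IsCornerMeasure L A m) (p : Plane) (b c : Bool) : corner m p b c ∈ ({0, 1} : Set ℝ) := by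
  obtain ⟨S, hS⟩ := h.exists_finite
  obtain ⟨r, hr, he⟩ := eventually_cdf_eq_corner hS p
  obtain ⟨z, h1, h2, -⟩ := exists_mem_arm_of_ae (P := fun _ => True)
    (Eventually.of_forall fun _ => trivial) p b c hr
  rw [← he z (abs_sub_lt_of_mem_arm h1) (abs_sub_lt_of_mem_arm h2) b c (arm_subset_side _ _ _ h1)
    (arm_subset_side _ _ _ h2)]
  exact h.cdf_mem z

/-! ### The gradient of an indicator function near a point -/

lemma integral_Iio_deriv (α : LineTest) (s : ℝ) : ∫ x in Iio s, deriv α x = α s := by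
  rw [← integral_Iic_eq_integral_Iio]
  exact α.hasCompactSupport.integral_Iic_deriv_eq (α.contDiff.of_le (by simp)) s

lemma LineTest.integrable (α : LineTest) : Integrable α :=
  α.continuous.integrable_of_hasCompactSupport α.hasCompactSupport

lemma integral_deriv_mul_step (α : LineTest) (x a b : ℝ) :
    ∫ t, deriv α t * (Iio x).indicator (fun _ => b) t + deriv α t * (Ici x).indicator (fun _ => a) t
      = (b - a) * α x := by
  have hi : Integrable (deriv α) := by
    have := LineTest.integrable (derivTest α)
    rwa [show (derivTest α : ℝ → ℝ) = deriv α from funext (derivTest_apply α)] at this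
  have e : ∀ (s : Set ℝ) (c : ℝ), (fun t => deriv α t * s.indicator (fun _ => c) t) =
      s.indicator fun t => deriv α t * c := fun s c => by
    ext t; by_cases ht : t ∈ s <;> simp [ht]
  rw [integral_add, e, e, integral_indicator measurableSet_Iio, integral_indicator measurableSet_Ici,
    integral_mul_const, integral_mul_const, integral_Iio_deriv, integral_Ici_deriv]
  · ring
  · rw [e]; exact (hi.mul_const _).indicator measurableSet_Iio
  · rw [e]; exact (hi.mul_const _).indicator measurableSet_Ici

/-- The derivative in the first variable of a function with a jump across a vertical segment. -/
lemma integral_deriv_mul_jump {F : Plane → ℝ} {x r R a b : ℝ} (hr : r < R) {J : Set ℝ}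
    (ha : ∀ z : Plane, |z.1 - x| < R → z.2 ∈ J → x ≤ z.1 → F z = a)
    (hb : ∀ z : Plane, |z.1 - x| < R → z.2 ∈ J → z.1 < x → F z = b) {α β : LineTest}
    (hα : ∀ t ∉ Ioo (x - r) (x + r), α t = 0) (hβ : ∀ t ∉ J, β t = 0) :
    ∫ z : Plane, deriv α z.1 * β z.2 * F z = (b - a) * (α x * ∫ t, β t) := by
  have hα' : ∀ t, deriv α t ≠ 0 → |t - x| < R := by
    intro t ht
    have h1 : t ∈ tsupport α := support_deriv_subset ht
    have h2 : tsupport α ⊆ Icc (x - r) (x + r) :=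
      closure_minimal (fun s hs => Ioo_subset_Icc_self (by_contra fun h => hs (hα s h))) isClosed_Icc
    rw [abs_lt]
    constructor <;> linarith [(h2 h1).1, (h2 h1).2]
  have e : ∀ z : Plane, deriv α z.1 * β z.2 * F z =
      (deriv α z.1 * (Iio x).indicator (fun _ => b) z.1 +
        deriv α z.1 * (Ici x).indicator (fun _ => a) z.1) * β z.2 := by
    intro z
    by_cases h1 : deriv α z.1 = 0
    · simp [h1]
    by_cases h2 : z.2 ∈ J
    · rcases lt_or_ge z.1 x with h | h
      · rw [hb z (hα' _ h1) h2 h]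
        simp [h]; ring
      · rw [ha z (hα' _ h1) h2 h]
        simp [h]; ring
    · simp [hβ _ h2]
  simp_rw [e]
  rw [Measure.volume_eq_prod, integral_prod_mul
    (fun t => deriv α t * (Iio x).indicator (fun _ => b) t +
      deriv α t * (Ici x).indicator (fun _ => a) t) (fun t => β t),
    integral_deriv_mul_step]
  ring

lemma IsCornerMeasure.D₁_tensor {L : ℝ} {A : Set Plane} {m : SignedMeasure Plane}
    (h : IsCornerMeasure L A m) (α β : LineTest) :
    D₁ (indicatorDistribution A) (tensor α β) = - ∫ z : Plane, deriv α z.1 * β z.2 * cdf m z := by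
  rw [D₁_apply, indicatorDistribution_apply h.nullMeasurable, lineDeriv_fst_tensor]
  congr 1
  refine integral_congr_ae (h.ae_eq.mono fun p hp => ?_)
  simp only [hp, tensor_apply, derivTest_apply]

/-- Swapping the coordinates lets `integral_deriv_mul_jump` serve for the second derivative too. -/
lemma IsCornerMeasure.D₂_tensor {L : ℝ} {A : Set Plane} {m : SignedMeasure Plane}
    (h : IsCornerMeasure L A m) (α β : LineTest) :
    D₂ (indicatorDistribution A) (tensor α β) =
      - ∫ z : Plane, deriv β z.1 * α z.2 * cdf m z.swap := by
  rw [D₂_apply, indicatorDistribution_apply h.nullMeasurable, lineDeriv_snd_tensor]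
  congr 1
  rw [Measure.volume_eq_prod, ← integral_prod_swap]
  have hs : ∀ᵐ z : Plane, A.indicator 1 z.swap = cdf m z.swap :=
    Measure.measurePreserving_swap.quasiMeasurePreserving.ae h.ae_eq
  refine integral_congr_ae (hs.mono fun p hp => ?_)
  simp only [hp, tensor_apply, derivTest_apply, Prod.fst_swap, Prod.snd_swap]
  ring

/-- Since `β` lives on one arm, the test function sees only the upper or only the lower half of the
vertical edge through `p`, where `cdf m` has a single constant jump. -/
lemma IsCornerMeasure.D₁_jump {L : ℝ} {A : Set Plane} {m : SignedMeasure Plane}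
    (h : IsCornerMeasure L A m) (p : Plane) : ∃ R > 0, ∀ r < R, ∀ (c : Bool) (α β : LineTest),
      (∀ t ∉ Ioo (p.1 - r) (p.1 + r), α t = 0) → (∀ t ∉ arm c p.2 r, β t = 0) →
      D₁ (indicatorDistribution A) (tensor α β) =
        (corner m p true c - corner m p false c) * (α p.1 * ∫ t, β t) := by
  obtain ⟨S, hS⟩ := h.exists_finite
  obtain ⟨R, hR, he⟩ := eventually_cdf_eq_corner hS p
  refine ⟨R, hR, fun r hr c α β hα hβ => ?_⟩
  rw [h.D₁_tensor, integral_deriv_mul_jump hr (a := corner m p true c) (b := corner m p false c)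
    (J := arm c p.2 r) ?_ ?_ hα hβ]
  · ring
  · exact fun z h1 h2 h3 => he z h1 ((abs_sub_lt_of_mem_arm h2).trans hr) true c h3
      (arm_subset_side _ _ _ h2)
  · exact fun z h1 h2 h3 => he z h1 ((abs_sub_lt_of_mem_arm h2).trans hr) false c h3
      (arm_subset_side _ _ _ h2)

lemma IsCornerMeasure.D₂_jump {L : ℝ} {A : Set Plane} {m : SignedMeasure Plane}
    (h : IsCornerMeasure L A m) (p : Plane) : ∃ R > 0, ∀ r < R, ∀ (b : Bool) (α β : LineTest),
      (∀ t ∉ arm b p.1 r, α t = 0) → (∀ t ∉ Ioo (p.2 - r) (p.2 + r), β t = 0) →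
      D₂ (indicatorDistribution A) (tensor α β) =
        (corner m p b true - corner m p b false) * ((∫ t, α t) * β p.2) := by
  obtain ⟨S, hS⟩ := h.exists_finite
  obtain ⟨R, hR, he⟩ := eventually_cdf_eq_corner hS p
  refine ⟨R, hR, fun r hr b α β hα hβ => ?_⟩
  rw [h.D₂_tensor, integral_deriv_mul_jump (F := fun z => cdf m z.swap) hr
    (a := corner m p b true) (b := corner m p b false) (J := arm b p.1 r) ?_ ?_ hβ hα]
  · ring
  · exact fun z h1 h2 h3 => he z.swap ((abs_sub_lt_of_mem_arm h2).trans hr) h1 b true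
      (arm_subset_side _ _ _ h2) h3
  · exact fun z h1 h2 h3 => he z.swap ((abs_sub_lt_of_mem_arm h2).trans hr) h1 b false
      (arm_subset_side _ _ _ h2) h3

/-! ### Absence of cancellation -/

/-- Subadditivity on `Uᶜ` and equality of the finite total masses leave no room for cancellation on
`U`. -/
lemma variation_eq_zero_of_add_eq_zero {X : Type*} [MeasurableSpace X] {μ ν : SignedMeasure X}
    (hadd : μ.variation univ + ν.variation univ = (μ + ν).variation univ) {U : Set X}
    (hU : MeasurableSet U) (h : (μ + ν).variation U = 0) : μ.variation U = 0 := by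
  have h1 : (μ + ν).variation univ ≤ μ.variation Uᶜ + ν.variation Uᶜ := by
    rw [← measure_add_measure_compl hU, h, zero_add]
    exact VectorMeasure.variation_add_le Uᶜ
  rw [← hadd, ← measure_add_measure_compl hU, ← measure_add_measure_compl (μ := ν.variation) hU]
    at h1
  have hf := measure_ne_top μ.variation Uᶜ
  have hg := measure_ne_top ν.variation Uᶜ
  have h2 : (μ.variation U + ν.variation U) + (μ.variation Uᶜ + ν.variation Uᶜ) ≤
      0 + (μ.variation Uᶜ + ν.variation Uᶜ) := by
    rw [zero_add]; refine le_trans (le_of_eq ?_) h1; ring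
  have h3 := (ENNReal.add_le_add_iff_right (ENNReal.add_ne_top.2 ⟨hf, hg⟩)).1 h2
  exact (add_eq_zero.1 (nonpos_iff_eq_zero.1 h3)).1

/-- If the variations of `μ` and `ν` add up, then their densities along a segment do not have
opposite signs. -/
lemma density_mul_nonneg {μ ν : SignedMeasure Plane}
    (hadd : μ.variation univ + ν.variation univ = (μ + ν).variation univ) {a b c d j k : ℝ}
    {l : LineTest → LineTest → ℝ}
    (hμ : ∀ α β : LineTest, (∀ t ∉ Ioo a b, α t = 0) → (∀ t ∉ Ioo c d, β t = 0) →
      ∫ᵛ p, tensor α β p ∂•μ = j * l α β)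
    (hν : ∀ α β : LineTest, (∀ t ∉ Ioo a b, α t = 0) → (∀ t ∉ Ioo c d, β t = 0) →
      ∫ᵛ p, tensor α β p ∂•ν = k * l α β)
    (hl : l (bump a b 1) (bump c d 1) ≠ 0)
    (hj : j ∈ ({-1, 0, 1} : Set ℝ)) (hk : k ∈ ({-1, 0, 1} : Set ℝ)) : 0 ≤ j * k := by
  have hU : MeasurableSet (Ioo a b ×ˢ Ioo c d) := measurableSet_Ioo.prod measurableSet_Ioo
  -- For values in `{-1, 0, 1}`, opposite signs mean `j + k = 0`. Then `μ + ν` vanishes on the box,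
  -- hence so does `μ`, and the bump product forces `j = 0`.
  have key : j + k = 0 → j = 0 := by
    intro hjk
    have h0 : (μ + ν).variation (Ioo a b ×ˢ Ioo c d) = 0 := by
      refine variation_box_eq_zero _ _ _ _ _ fun α β hα hβ => ?_
      rw [VectorMeasure.integral_add_vectorMeasure (PlaneTest.integrable_vectorMeasure _ _)
        (PlaneTest.integrable_vectorMeasure _ _), hμ α β hα hβ, hν α β hα hβ, ← add_mul, hjk,
        zero_mul]
    have h1 := variation_eq_zero_of_add_eq_zero hadd hU h0
    have h2 := hμ (bump a b 1) (bump c d 1) (fun t ht => bump_eq_zero 1 ht)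
      (fun t ht => bump_eq_zero 1 ht)
    rw [VectorMeasure.integral_eq_zero_of_ae] at h2
    · exact (mul_eq_zero.1 h2.symm).resolve_right hl
    · have : ∀ᵐ p ∂μ.variation, p ∉ Ioo a b ×ˢ Ioo c d := measure_eq_zero_iff_ae_notMem.1 h1
      filter_upwards [this] with p hp
      rw [tensor_apply, Pi.zero_apply]
      by_cases h1 : p.1 ∈ Ioo a b
      · rw [bump_eq_zero 1 (fun h2 => hp ⟨h1, h2⟩), mul_zero]
      · rw [bump_eq_zero 1 h1, zero_mul]
  rcases hj with rfl | rfl | rfl <;> rcases hk with rfl | rfl | rfl <;>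
    first | (norm_num; done) | norm_num at key

lemma integral_bump_pos {a b : ℝ} (h : a < b) : 0 < ∫ t, bump a b 1 t := by
  have hm : (a + b) / 2 ∈ Ioo a b := ⟨by linarith, by linarith⟩
  exact (bump a b 1).continuous.integral_pos_of_hasCompactSupport_nonneg_nonzero
    (bump a b 1).hasCompactSupport (bump_nonneg a b 1) (bump_pos one_pos hm).ne'

lemma exists_arm_eq_Ioo (b : Bool) (x : ℝ) {r : ℝ} (hr : 0 < r) :
    ∃ c d, c < d ∧ arm b x r = Ioo c d := by
  cases b
  exacts [⟨x - r, x, by linarith, rfl⟩, ⟨x, x + r, by linarith, rfl⟩]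

lemma sub_mem_of_mem {a b : ℝ} (ha : a ∈ ({0, 1} : Set ℝ)) (hb : b ∈ ({0, 1} : Set ℝ)) :
    a - b ∈ ({-1, 0, 1} : Set ℝ) := by
  rcases ha with rfl | rfl <;> rcases hb with rfl | rfl <;> norm_num

section Additive

variable {L : ℝ} {A B : Set Plane} {m n : SignedMeasure Plane}

lemma IsCornerMeasure.D₁_jump_mul_nonneg (hA : IsCornerMeasure L A m) (hB : IsCornerMeasure L B n)
    {μ ν : SignedMeasure Plane} (hμ : IsGivenBy (D₁ (indicatorDistribution A)) μ)
    (hν : IsGivenBy (D₁ (indicatorDistribution B)) ν)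
    (hadd : μ.variation univ + ν.variation univ = (μ + ν).variation univ) (p : Plane) (c : Bool) :
    0 ≤ (corner m p true c - corner m p false c) * (corner n p true c - corner n p false c) := by
  obtain ⟨R, hR, h1⟩ := hA.D₁_jump p
  obtain ⟨R', hR', h2⟩ := hB.D₁_jump p
  have hr : 0 < min R R' / 2 := by positivity
  have hrR : min R R' / 2 < R := (half_lt_self (by positivity)).trans_le (min_le_left _ _)
  have hrR' : min R R' / 2 < R' := (half_lt_self (by positivity)).trans_le (min_le_right _ _)
  obtain ⟨y, y', hy, e⟩ := exists_arm_eq_Ioo c p.2 hr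
  refine density_mul_nonneg hadd (a := p.1 - min R R' / 2) (b := p.1 + min R R' / 2) (c := y)
    (d := y') (l := fun α β => α p.1 * ∫ t, β t) ?_ ?_ ?_
    (sub_mem_of_mem (hA.corner_mem _ _ _) (hA.corner_mem _ _ _))
    (sub_mem_of_mem (hB.corner_mem _ _ _) (hB.corner_mem _ _ _))
  · intro α β hα hβ
    rw [← hμ]
    exact h1 _ hrR c α β hα (by rwa [e])
  · intro α β hα hβ
    rw [← hν]
    exact h2 _ hrR' c α β hα (by rwa [e])
  · exact (mul_pos (bump_pos one_pos ⟨by linarith, by linarith⟩) (integral_bump_pos hy)).ne'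

lemma IsCornerMeasure.D₂_jump_mul_nonneg (hA : IsCornerMeasure L A m) (hB : IsCornerMeasure L B n)
    {μ ν : SignedMeasure Plane} (hμ : IsGivenBy (D₂ (indicatorDistribution A)) μ)
    (hν : IsGivenBy (D₂ (indicatorDistribution B)) ν)
    (hadd : μ.variation univ + ν.variation univ = (μ + ν).variation univ) (p : Plane) (b : Bool) :
    0 ≤ (corner m p b true - corner m p b false) * (corner n p b true - corner n p b false) := by
  obtain ⟨R, hR, h1⟩ := hA.D₂_jump p
  obtain ⟨R', hR', h2⟩ := hB.D₂_jump p
  have hr : 0 < min R R' / 2 := by positivity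
  have hrR : min R R' / 2 < R := (half_lt_self (by positivity)).trans_le (min_le_left _ _)
  have hrR' : min R R' / 2 < R' := (half_lt_self (by positivity)).trans_le (min_le_right _ _)
  obtain ⟨x, x', hx, e⟩ := exists_arm_eq_Ioo b p.1 hr
  refine density_mul_nonneg hadd (a := x) (b := x') (c := p.2 - min R R' / 2)
    (d := p.2 + min R R' / 2) (l := fun α β => (∫ t, α t) * β p.2) ?_ ?_ ?_
    (sub_mem_of_mem (hA.corner_mem _ _ _) (hA.corner_mem _ _ _))
    (sub_mem_of_mem (hB.corner_mem _ _ _) (hB.corner_mem _ _ _))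
  · intro α β hα hβ
    rw [← hμ]
    exact h1 _ hrR b α β (by rwa [e]) hβ
  · intro α β hα hβ
    rw [← hν]
    exact h2 _ hrR' b α β (by rwa [e]) hβ
  · exact (mul_pos (integral_bump_pos hx) (bump_pos one_pos ⟨by linarith, by linarith⟩)).ne'

/-- If the anisotropic total variations of two disjoint sets add up, then across no edge do their
indicator functions jump in opposite directions. -/
lemma IsCornerMeasure.jump_mul_nonneg (hA : IsCornerMeasure L A m) (hB : IsCornerMeasure L B n)
    (hd : Disjoint A B)
    (hadd : gradNorm (indicatorDistribution A) + gradNorm (indicatorDistribution B) =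
      gradNorm (indicatorDistribution (A ∪ B)))
    (hfin : gradNorm (indicatorDistribution (A ∪ B)) < ∞) (p : Plane) :
    (∀ c, 0 ≤ (corner m p true c - corner m p false c) *
      (corner n p true c - corner n p false c)) ∧
    ∀ b, 0 ≤ (corner m p b true - corner m p b false) *
      (corner n p b true - corner n p b false) := by
  have hfin' := hfin
  rw [← hadd] at hfin'
  obtain ⟨⟨hA2, hA1⟩, hB2, hB1⟩ : (measureNorm (D₂ (indicatorDistribution A)) < ∞ ∧
      measureNorm (D₁ (indicatorDistribution A)) < ∞) ∧
      measureNorm (D₂ (indicatorDistribution B)) < ∞ ∧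
      measureNorm (D₁ (indicatorDistribution B)) < ∞ := by
    simpa only [gradNorm, ENNReal.add_lt_top] using hfin'
  obtain ⟨μ, hμ⟩ := exists_isGivenBy hA1
  obtain ⟨ν, hν⟩ := exists_isGivenBy hB1
  obtain ⟨μ', hμ'⟩ := exists_isGivenBy hA2
  obtain ⟨ν', hν'⟩ := exists_isGivenBy hB2
  have h1 := hμ.add hν
  have h2 := hμ'.add hν'
  rw [← D₁_add] at h1
  rw [← D₂_add] at h2
  rw [indicatorDistribution_union hA.nullMeasurable hB.nullMeasurable hd] at hadd
  simp only [gradNorm, hμ.measureNorm_eq, hν.measureNorm_eq, hμ'.measureNorm_eq,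
    hν'.measureNorm_eq, h1.measureNorm_eq, h2.measureNorm_eq] at hadd
  have i1 : (μ + ν).variation univ ≤ μ.variation univ + ν.variation univ :=
    VectorMeasure.variation_add_le univ
  have i2 : (μ' + ν').variation univ ≤ μ'.variation univ + ν'.variation univ :=
    VectorMeasure.variation_add_le univ
  have hadd' : (μ'.variation univ + ν'.variation univ) + (μ.variation univ + ν.variation univ) =
      (μ' + ν').variation univ + (μ + ν).variation univ := by rw [← hadd]; ring
  -- Each partial derivative is subadditive; finiteness turns equality of the sums into equality for
  -- each derivative.
  have e1 : μ.variation univ + ν.variation univ = (μ + ν).variation univ := by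
    refine le_antisymm ?_ i1
    refine (ENNReal.add_le_add_iff_left (measure_ne_top (μ' + ν').variation univ)).1 ?_
    rw [← hadd']
    exact add_le_add_left i2 _
  have e2 : μ'.variation univ + ν'.variation univ = (μ' + ν').variation univ := by
    rw [e1] at hadd'
    exact (ENNReal.add_left_inj (measure_ne_top _ _)).1 hadd'
  exact ⟨hA.D₁_jump_mul_nonneg hB hμ hν e1 p, hA.D₂_jump_mul_nonneg hB hμ' hν' e2 p⟩

/-! ### Additivity of the mixed norm -/

lemma variation_univ_eq_sum {m : SignedMeasure Plane} {S : Finset Plane}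
    (hS : m.variation (S : Set Plane)ᶜ = 0) : m.variation univ = ∑ s ∈ S, ‖m {s}‖ₑ := by
  have hs : ∀ s : Plane, m.variation {s} = ‖m {s}‖ₑ := by
    intro s
    refine le_antisymm ?_ (VectorMeasure.enorm_measure_le_variation m _)
    have := VectorMeasure.variation_apply_le_of_forall_enorm_le (μ := m)
      (m := ‖m {s}‖ₑ • Measure.dirac s) (measurableSet_singleton s) fun E _ hE => ?_
    · simpa using this
    · rcases subset_singleton_iff_eq.1 hE with rfl | rfl <;> simp
  rw [← measure_add_measure_compl S.measurableSet, hS, add_zero, ← sum_measure_singleton]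
  exact Finset.sum_congr rfl fun s _ => hs s

/-- On a common finite carrier the variation is the sum of the absolute values of the atoms, and
absolute values add when signs are not opposite. -/
lemma variation_univ_add {m n : SignedMeasure Plane} {S T : Finset Plane}
    (hS : m.variation (S : Set Plane)ᶜ = 0) (hT : n.variation (T : Set Plane)ᶜ = 0)
    (h : ∀ p, 0 ≤ m {p} * n {p}) :
    m.variation univ + n.variation univ = (m + n).variation univ := by
  classical
  have hS' : m.variation ((S ∪ T : Finset Plane) : Set Plane)ᶜ = 0 :=
    measure_mono_null (compl_subset_compl.2 (by simp)) hS
  have hT' : n.variation ((S ∪ T : Finset Plane) : Set Plane)ᶜ = 0 :=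
    measure_mono_null (compl_subset_compl.2 (by simp)) hT
  have hST : (m + n).variation ((S ∪ T : Finset Plane) : Set Plane)ᶜ = 0 := by
    have := VectorMeasure.variation_add_le (μ := m) (ν := n) ((S ∪ T : Finset Plane) : Set Plane)ᶜ
    rw [Measure.add_apply, hS', hT', add_zero] at this
    exact le_antisymm this zero_le
  rw [variation_univ_eq_sum hS', variation_univ_eq_sum hT', variation_univ_eq_sum hST,
    ← Finset.sum_add_distrib]
  refine Finset.sum_congr rfl fun p _ => ?_
  rw [_root_.add_apply, ← ofReal_norm, ← ofReal_norm, ← ofReal_norm, Real.norm_eq_abs,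
    Real.norm_eq_abs, Real.norm_eq_abs, (abs_add_eq_add_abs_iff _ _).2 (mul_nonneg_iff.1 (h p)),
    ENNReal.ofReal_add (abs_nonneg _) (abs_nonneg _)]

lemma IsCornerMeasure.mixedNorm_eq (hA : IsCornerMeasure L A m) :
    mixedNorm (indicatorDistribution A) = m.variation univ :=
  hA.isGivenBy.measureNorm_eq

lemma IsCornerMeasure.mixedNorm_add (hA : IsCornerMeasure L A m) (hB : IsCornerMeasure L B n)
    (hd : Disjoint A B) (h : ∀ p, 0 ≤ m {p} * n {p}) :
    mixedNorm (indicatorDistribution A) + mixedNorm (indicatorDistribution B) =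
      mixedNorm (indicatorDistribution (A ∪ B)) := by
  obtain ⟨S, hS⟩ := hA.exists_finite
  obtain ⟨T, hT⟩ := hB.exists_finite
  rw [hA.mixedNorm_eq, hB.mixedNorm_eq, (hA.union hB hd).mixedNorm_eq, variation_univ_add hS hT h]

/-- The union is again a set with corner values in `{0, 1}`, so the two pieces cannot both have the
value 1. -/
lemma IsCornerMeasure.corner_mul_corner (hA : IsCornerMeasure L A m) (hB : IsCornerMeasure L B n)
    (hd : Disjoint A B) (p : Plane) (b c : Bool) : corner m p b c * corner n p b c = 0 := by
  have h := (hA.union hB hd).corner_mem p b c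
  rw [corner_add] at h
  rcases hA.corner_mem p b c with h1 | h1
  · rw [h1, zero_mul]
  rcases hB.corner_mem p b c with h2 | h2
  · rw [h2, mul_zero]
  rw [mem_singleton_iff] at h1 h2
  rw [h1, h2] at h
  norm_num at h

lemma IsCornerMeasure.corner_nonneg (hA : IsCornerMeasure L A m) (p : Plane) (b c : Bool) :
    0 ≤ corner m p b c := by
  rcases hA.corner_mem p b c with h1 | h1
  · rw [h1]
  · rw [mem_singleton_iff.1 h1]; exact zero_le_one

/-- Expand the product of the two alternating sums. Products at the same quadrant vanish by
disjointness. Products at adjacent quadrants enter with a minus sign and are controlled by the jump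
inequalities. Products at opposite quadrants enter with a plus sign and are nonnegative. -/
lemma IsCornerMeasure.apply_singleton_mul_nonneg (hA : IsCornerMeasure L A m)
    (hB : IsCornerMeasure L B n) (hd : Disjoint A B) (p : Plane)
    (h : (∀ c, 0 ≤ (corner m p true c - corner m p false c) *
        (corner n p true c - corner n p false c)) ∧
      ∀ b, 0 ≤ (corner m p b true - corner m p b false) *
        (corner n p b true - corner n p b false)) : 0 ≤ m {p} * n {p} := by
  rw [apply_singleton, apply_singleton]
  have h1 := h.1 true
  have h2 := h.1 false
  have h3 := h.2 true
  have h4 := h.2 false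
  have z := hA.corner_mul_corner hB hd p
  have z1 := z true true
  have z2 := z true false
  have z3 := z false true
  have z4 := z false false
  have pos := fun b c b' c' => mul_nonneg (hA.corner_nonneg p b c) (hB.corner_nonneg p b' c')
  have p1 := pos true true false false
  have p2 := pos false false true true
  have p3 := pos true false false true
  have p4 := pos false true true false
  linarith

/-- The same partition works, and finiteness is automatic because the mixed derivative is a bounded
measure. -/
lemma isMixedDecomposable_of_isGradDecomposable {L : ℝ} {A : Set Plane}
    (h : IsGradDecomposable (square L) A) : IsMixedDecomposable (square L) A := by
  obtain ⟨A₁, A₂, hd, rfl, h₁, h₂, hadd, hfin, hv₁, hv₂⟩ := h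
  obtain ⟨m, hm⟩ := h₁.exists_isCornerMeasure
  obtain ⟨n, hn⟩ := h₂.exists_isCornerMeasure
  refine ⟨A₁, A₂, hd, rfl, h₁, h₂, hm.mixedNorm_add hn hd fun p =>
    hm.apply_singleton_mul_nonneg hn hd p (hm.jump_mul_nonneg hn hd hadd hfin p), ?_, hv₁, hv₂⟩
  rw [(hm.union hn hd).mixedNorm_eq]
  exact measure_lt_top _ _

end Additive

/-! ### Indecomposability of connected sets -/

/-- Every quadrant at `p` contains points of `O` arbitrarily near `p` where the union's distribution
function equals its indicator, which is 1. -/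
lemma IsCornerMeasure.corner_add_eq_one {L : ℝ} {A B O : Set Plane} {m n : SignedMeasure Plane}
    (hA : IsCornerMeasure L A m) (hB : IsCornerMeasure L B n) (hd : Disjoint A B)
    (hO : IsOpen O) (hOA : O ⊆ A ∪ B) {p : Plane} (hp : p ∈ O) (b c : Bool) :
    corner m p b c + corner n p b c = 1 := by
  obtain ⟨S, hS⟩ := (hA.union hB hd).exists_finite
  obtain ⟨R, hR, he⟩ := eventually_cdf_eq_corner hS p
  obtain ⟨ε, hε, hball⟩ := Metric.isOpen_iff.1 hO p hp
  obtain ⟨z, h1, h2, hz⟩ := exists_mem_arm_of_ae (hA.union hB hd).ae_eq p b c (lt_min hR hε)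
  have h1' := abs_sub_lt_of_mem_arm h1
  have h2' := abs_sub_lt_of_mem_arm h2
  have hzO : z ∈ O := hball (max_lt (h1'.trans_le (min_le_right _ _))
    (h2'.trans_le (min_le_right _ _)))
  rw [← corner_add, ← he z (h1'.trans_le (min_le_left _ _)) (h2'.trans_le (min_le_left _ _)) b c
    (arm_subset_side _ _ _ h1) (arm_subset_side _ _ _ h2), ← hz, indicator_of_mem (hOA hzO)]
  rfl

lemma IsCornerMeasure.continuousAt_cdf {L : ℝ} {A : Set Plane} {m : SignedMeasure Plane}
    (hA : IsCornerMeasure L A m) {p : Plane}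
    (h : ∀ b c, corner m p b c = corner m p true true) : ContinuousAt (cdf m) p := by
  obtain ⟨S, hS⟩ := hA.exists_finite
  obtain ⟨R, hR, he⟩ := eventually_cdf_eq_corner hS p
  have hside : ∀ x t : ℝ, ∃ b, t ∈ side b x := fun x t => by
    rcases lt_or_ge t x with h | h
    exacts [⟨false, h⟩, ⟨true, h⟩]
  have hev : ∀ᶠ z in 𝓝 p, cdf m p = cdf m z := by
    filter_upwards [Metric.ball_mem_nhds p hR] with z hz
    obtain ⟨b, hb⟩ := hside p.1 z.1
    obtain ⟨c, hc⟩ := hside p.2 z.2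
    have hz' : dist z.1 p.1 < R ∧ dist z.2 p.2 < R := max_lt_iff.1 hz
    rw [he z hz'.1 hz'.2 b c hb hc, h b c]
    rfl
  exact tendsto_const_nhds.congr' hev

/-- A set which agrees up to a null set with a connected open subset is indecomposable for the
anisotropic total variation. -/
lemma not_isGradDecomposable_of_isPreconnected {L : ℝ} {A O : Set Plane} (hO : IsOpen O)
    (hc : IsPreconnected O) (hOA : O ⊆ A) (hnull : volume (A \ O) = 0) :
    ¬ IsGradDecomposable (square L) A := by
  rintro ⟨A₁, A₂, hd, rfl, h₁, h₂, hadd, hfin, hv₁, hv₂⟩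
  obtain ⟨m, hm⟩ := h₁.exists_isCornerMeasure
  obtain ⟨n, hn⟩ := h₂.exists_isCornerMeasure
  have hcont : ContinuousOn (cdf m) O := by
    intro p hp
    refine (hm.continuousAt_cdf ?_).continuousWithinAt
    have hone := fun b c => hm.corner_add_eq_one hn hd hO hOA hp b c
    have hjump := hm.jump_mul_nonneg hn hd hadd hfin p
    -- Values summing to 1 have opposite jumps, so a nonnegative product of jumps is minus a square
    -- and the jump is 0.
    have key : ∀ a b a' b' : ℝ, a + a' = 1 → b + b' = 1 → 0 ≤ (a - b) * (a' - b') → a = b := by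
      intro a b a' b' h1 h2 h3
      have : (a - b) ^ 2 ≤ 0 := by
        rw [show a' - b' = -(a - b) by linarith] at h3
        linarith [sq (a - b)]
      linarith [pow_eq_zero_iff (two_ne_zero) |>.1 (le_antisymm this (sq_nonneg _))]
    have e1 := fun c => key _ _ _ _ (hone true c) (hone false c) (hjump.1 c)
    have e2 := fun b => key _ _ _ _ (hone b true) (hone b false) (hjump.2 b)
    intro b c
    cases b <;> cases c
    · rw [← e2, ← e1]
    · rw [← e1]
    · rw [← e2]
    · rfl
  -- A continuous function into the discrete set `{0, 1}` is constant on the preconnected `O`; the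
  -- value 0 makes `A₁` null, the value 1 makes `A₂` null.
  obtain ⟨y, hy, hconst⟩ := hc.eqOn_const_of_mapsTo (toFinite ({0, 1} : Set ℝ)).isDiscrete hcont
    (fun p _ => hm.cdf_mem p) ⟨0, by simp⟩
  have hzero : ∀ B ⊆ A₁ ∪ A₂, (∀ᵐ p : Plane, p ∈ O → p ∉ B) → volume B = 0 := by
    intro B hB h
    have h' : ∀ᵐ p : Plane, p ∉ (A₁ ∪ A₂) \ O := measure_eq_zero_iff_ae_notMem.1 hnull
    refine measure_eq_zero_iff_ae_notMem.2 ?_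
    filter_upwards [h, h'] with p h1 h2 hp
    exact h1 (by_contra fun h3 => h2 ⟨hB hp, h3⟩) hp
  rcases hy with rfl | rfl
  · refine hv₁.ne' (hzero A₁ subset_union_left ?_)
    filter_upwards [hm.ae_eq] with p hp hpO hpA
    rw [indicator_of_mem hpA, hconst hpO] at hp
    exact one_ne_zero hp
  · refine hv₂.ne' (hzero A₂ subset_union_right ?_)
    filter_upwards [hm.ae_eq] with p hp hpO hpA
    rw [indicator_of_notMem (Set.disjoint_right.1 hd hpA), hconst hpO] at hp
    exact zero_ne_one hp

/-! ### Rectangles -/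

/-- The mixed derivative of the indicator function of the rectangle `[a, b] × [c, d]`. -/
noncomputable def rectangleMeasure (a b c d : ℝ) : SignedMeasure Plane :=
  (VectorMeasure.dirac ((b, d) : Plane) (1 : ℝ) - VectorMeasure.dirac ((b, c) : Plane) (1 : ℝ)) -
  (VectorMeasure.dirac ((a, d) : Plane) (1 : ℝ) - VectorMeasure.dirac ((a, c) : Plane) (1 : ℝ))

lemma integral_rectangleMeasure (a b c d : ℝ) (φ : PlaneTest) :
    ∫ᵛ p, φ p ∂•(rectangleMeasure a b c d) = φ (b, d) - φ (b, c) - (φ (a, d) - φ (a, c)) := by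
  have hi := fun μ => PlaneTest.integrable_vectorMeasure φ μ
  rw [rectangleMeasure, VectorMeasure.integral_sub_vectorMeasure (hi _) (hi _),
    VectorMeasure.integral_sub_vectorMeasure (hi _) (hi _),
    VectorMeasure.integral_sub_vectorMeasure (hi _) (hi _)]
  simp

lemma rectangleMeasure_apply_eq_zero {a b c d : ℝ} {s : Set Plane} (h1 : ((b, d) : Plane) ∉ s)
    (h2 : ((b, c) : Plane) ∉ s) (h3 : ((a, d) : Plane) ∉ s) (h4 : ((a, c) : Plane) ∉ s) :
    rectangleMeasure a b c d s = 0 := by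
  have hz : ∀ p : Plane, p ∉ s → VectorMeasure.dirac p (1 : ℝ) s = 0 := fun p hp =>
    if_neg fun h => hp h.2
  simp only [rectangleMeasure, _root_.sub_apply, hz _ h1, hz _ h2, hz _ h3, hz _ h4, sub_self]

lemma integral_lineDeriv_fst (φ : PlaneTest) (y : ℝ) {a b : ℝ} (h : a ≤ b) :
    ∫ x in Icc a b, (∂_{((1, 0) : Plane)} φ) (x, y) = φ (b, y) - φ (a, y) := by
  rw [integral_Icc_eq_integral_Ioc, ← intervalIntegral.integral_of_le h]
  refine intervalIntegral.integral_eq_sub_of_hasDerivAt (f := fun x => φ (x, y)) (fun x _ => ?_) ?_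
  · rw [lineDeriv_fst_apply]
    exact ((PlaneTest.differentiable φ).comp (by fun_prop : Differentiable ℝ
      fun t : ℝ => ((t, y) : Plane)) x).hasDerivAt
  · exact ((TestFunction.continuous _).comp (by fun_prop : Continuous
      fun t : ℝ => ((t, y) : Plane))).intervalIntegrable _ _

lemma integral_lineDeriv_snd (φ : PlaneTest) (x : ℝ) {c d : ℝ} (h : c ≤ d) :
    ∫ y in Icc c d, (∂_{((0, 1) : Plane)} φ) (x, y) = φ (x, d) - φ (x, c) := by
  rw [integral_Icc_eq_integral_Ioc, ← intervalIntegral.integral_of_le h]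
  refine intervalIntegral.integral_eq_sub_of_hasDerivAt (f := fun y => φ (x, y)) (fun y _ => ?_) ?_
  · rw [lineDeriv_snd_apply]
    exact ((PlaneTest.differentiable φ).comp (by fun_prop : Differentiable ℝ
      fun t : ℝ => ((x, t) : Plane)) y).hasDerivAt
  · exact ((TestFunction.continuous _).comp (by fun_prop : Continuous
      fun t : ℝ => ((x, t) : Plane))).intervalIntegrable _ _

/-- The fundamental theorem of calculus in each variable. Only almost everywhere equality with the
closed rectangle is asked, so that a half-open rectangle is covered too. -/
lemma isCornerMeasure_rectangle {L a b c d : ℝ} (hab : a ≤ b) (hcd : c ≤ d) {A : Set Plane}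
    (hsub : Icc a b ×ˢ Icc c d ⊆ square L) (hA : A ⊆ square L)
    (hae : A =ᵐ[volume] Icc a b ×ˢ Icc c d) :
    IsCornerMeasure L A (rectangleMeasure a b c d) := by
  have hR : MeasurableSet (Icc a b ×ˢ Icc c d) := measurableSet_Icc.prod measurableSet_Icc
  have hnull : NullMeasurableSet A volume := hR.nullMeasurableSet.congr hae.symm
  refine ⟨hA, hnull, ?_, fun φ => ?_⟩
  · have hK : MeasurableSet (square L) := measurableSet_Icc.prod measurableSet_Icc
    rw [VectorMeasure.variation_apply_eq_zero hK.compl]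
    intro t ht _
    have hmem : ∀ x y : ℝ, x ∈ Icc a b → y ∈ Icc c d → ((x, y) : Plane) ∉ t :=
      fun x y hx hy h => ht h (hsub ⟨hx, hy⟩)
    exact rectangleMeasure_apply_eq_zero
      (hmem _ _ (right_mem_Icc.2 hab) (right_mem_Icc.2 hcd))
      (hmem _ _ (right_mem_Icc.2 hab) (left_mem_Icc.2 hcd))
      (hmem _ _ (left_mem_Icc.2 hab) (right_mem_Icc.2 hcd))
      (hmem _ _ (left_mem_Icc.2 hab) (left_mem_Icc.2 hcd))
  · rw [indicatorDistribution_congr hnull hae, DD_apply,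
      indicatorDistribution_apply hR.nullMeasurableSet, integral_rectangleMeasure]
    set G : PlaneTest := ∂_{((1, 0) : Plane)} φ with hG
    set H : PlaneTest := ∂_{((0, 1) : Plane)} G with hH
    have e : ∀ p, H p * (Icc a b ×ˢ Icc c d).indicator 1 p =
        (Icc a b ×ˢ Icc c d).indicator H p := fun p => by
      by_cases hp : p ∈ Icc a b ×ˢ Icc c d
      · rw [indicator_of_mem hp, indicator_of_mem hp, Pi.one_apply, mul_one]
      · rw [indicator_of_notMem hp, indicator_of_notMem hp, mul_zero]
    have hi : ∀ y, IntegrableOn (fun x => G (x, y)) (Icc a b) := fun y =>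
      (G.continuous.comp (by fun_prop : Continuous
        fun t : ℝ => ((t, y) : Plane))).integrableOn_Icc
    simp_rw [e]
    rw [integral_indicator hR, Measure.volume_eq_prod,
      setIntegral_prod _ (PlaneTest.integrable H).integrableOn]
    simp_rw [hH, integral_lineDeriv_snd G _ hcd]
    rw [integral_sub (hi d) (hi c), hG, integral_lineDeriv_fst φ _ hab,
      integral_lineDeriv_fst φ _ hab]
    ring

/-! ### The union of two rectangles -/

section TwoRectangles

variable {L c : ℝ}

/-- The common edge is given to the base, which makes the two pieces disjoint. -/
lemma twoRectangles_eq (c : ℝ) (hc : 0 < c) : (Icc 0 (3 * c) ×ˢ Icc 0 c) ∪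
    (Icc c (2 * c) ×ˢ Ioc c (2 * c)) = twoRectangles c := by
  ext p
  simp only [twoRectangles, mem_union, mem_prod, mem_Icc, mem_Ioc]
  constructor
  · rintro (h | h)
    · exact Or.inl h
    · exact Or.inr ⟨h.1, h.2.1.le, h.2.2⟩
  · rintro (h | h)
    · exact Or.inl h
    · rcases h.2.1.lt_or_eq with h' | h'
      · exact Or.inr ⟨h.1, h', h.2.2⟩
      · exact Or.inl ⟨⟨by linarith [h.1.1], by linarith [h.1.2]⟩, by linarith, h'.ge⟩

lemma isCornerMeasure_base (hc : 0 < c) (hL : 3 * c ≤ L) :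
    IsCornerMeasure L (Icc 0 (3 * c) ×ˢ Icc 0 c) (rectangleMeasure 0 (3 * c) 0 c) := by
  have h : Icc 0 (3 * c) ×ˢ Icc 0 c ⊆ square L :=
    prod_mono (Icc_subset_Icc le_rfl hL) (Icc_subset_Icc le_rfl (by linarith))
  exact isCornerMeasure_rectangle (by linarith) hc.le h h (ae_eq_refl _)

lemma isCornerMeasure_top (hc : 0 < c) (hL : 3 * c ≤ L) :
    IsCornerMeasure L (Icc c (2 * c) ×ˢ Ioc c (2 * c)) (rectangleMeasure c (2 * c) c (2 * c)) := by
  have h : Icc c (2 * c) ×ˢ Icc c (2 * c) ⊆ square L :=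
    prod_mono (Icc_subset_Icc hc.le (by linarith)) (Icc_subset_Icc hc.le (by linarith))
  refine isCornerMeasure_rectangle (by linarith) (by linarith) h
    ((prod_mono_right Ioc_subset_Icc_self).trans h) ?_
  rw [Measure.volume_eq_prod]
  exact Measure.set_prod_ae_eq (ae_eq_refl _) Ioc_ae_eq_Icc

lemma disjoint_base_top (c : ℝ) :
    Disjoint (Icc 0 (3 * c) ×ˢ Icc 0 c) (Icc c (2 * c) ×ˢ Ioc c (2 * c)) :=
  Set.disjoint_left.2 fun _ h h' => h'.2.1.not_ge h.2.2

lemma isAdmissible_twoRectangles (hc : 0 < c) (hL : 3 * c ≤ L) :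
    IsAdmissible (square L) (twoRectangles c) := by
  rw [← twoRectangles_eq c hc]
  exact ((isCornerMeasure_base hc hL).union (isCornerMeasure_top hc hL)
    (disjoint_base_top c)).isAdmissible

lemma isMixedDecomposable_twoRectangles (hc : 0 < c) (hL : 3 * c ≤ L) :
    IsMixedDecomposable (square L) (twoRectangles c) := by
  have h1 := isCornerMeasure_base hc hL
  have h2 := isCornerMeasure_top hc hL
  have hd := disjoint_base_top c
  rw [← twoRectangles_eq c hc]
  refine ⟨_, _, hd, rfl, h1.isAdmissible, h2.isAdmissible, h1.mixedNorm_add h2 hd fun p => ?_, ?_,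
    ?_, ?_⟩
  -- The atoms of the base have abscissa 0 or `3 * c`, those of the top `c` or `2 * c`, so no point
  -- carries atoms of both.
  · by_cases hp : p.1 = 0 ∨ p.1 = 3 * c
    · have hx : c ≠ p.1 ∧ 2 * c ≠ p.1 := by
        constructor <;> intro h <;> rcases hp with hp | hp <;> linarith
      rw [rectangleMeasure_apply_eq_zero (a := c), mul_zero]
      · exact fun h => hx.2 (congrArg Prod.fst h)
      · exact fun h => hx.2 (congrArg Prod.fst h)
      · exact fun h => hx.1 (congrArg Prod.fst h)
      · exact fun h => hx.1 (congrArg Prod.fst h)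
    · rw [not_or] at hp
      rw [rectangleMeasure_apply_eq_zero (a := 0), zero_mul]
      · exact fun h => hp.2 (congrArg Prod.fst h).symm
      · exact fun h => hp.2 (congrArg Prod.fst h).symm
      · exact fun h => hp.1 (congrArg Prod.fst h).symm
      · exact fun h => hp.1 (congrArg Prod.fst h).symm
  · rw [(h1.union h2 hd).mixedNorm_eq]
    exact measure_lt_top _ _
  · rw [Measure.volume_eq_prod, Measure.prod_prod, Real.volume_Icc, Real.volume_Icc]
    exact ENNReal.mul_pos (ENNReal.ofReal_pos.2 (by linarith)).ne'
      (ENNReal.ofReal_pos.2 (by linarith)).ne'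
  · rw [Measure.volume_eq_prod, Measure.prod_prod, Real.volume_Icc, Real.volume_Ioc]
    exact ENNReal.mul_pos (ENNReal.ofReal_pos.2 (by linarith)).ne'
      (ENNReal.ofReal_pos.2 (by linarith)).ne'

lemma not_isGradDecomposable_twoRectangles (hc : 0 < c) :
    ¬ IsGradDecomposable (square L) (twoRectangles c) := by
  -- The second open rectangle is prolonged down to height 0, so that it crosses the common edge and
  -- overlaps the first one; this makes `O` connected.
  set O : Set Plane := (Ioo 0 (3 * c) ×ˢ Ioo 0 c) ∪ (Ioo c (2 * c) ×ˢ Ioo 0 (2 * c)) with hO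
  refine not_isGradDecomposable_of_isPreconnected (O := O)
    ((isOpen_Ioo.prod isOpen_Ioo).union (isOpen_Ioo.prod isOpen_Ioo)) ?_ ?_ ?_
  · refine IsPreconnected.union ((3 / 2 * c, 1 / 2 * c) : Plane) ?_ ?_
      (isPreconnected_Ioo.prod isPreconnected_Ioo) (isPreconnected_Ioo.prod isPreconnected_Ioo)
    · exact ⟨⟨by dsimp only; linarith, by dsimp only; linarith⟩,
        ⟨by dsimp only; linarith, by dsimp only; linarith⟩⟩
    · exact ⟨⟨by dsimp only; linarith, by dsimp only; linarith⟩,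
        ⟨by dsimp only; linarith, by dsimp only; linarith⟩⟩
  · rintro p (⟨h1, h2⟩ | ⟨h1, h2⟩)
    · exact Or.inl ⟨Ioo_subset_Icc_self h1, Ioo_subset_Icc_self h2⟩
    · rcases le_total p.2 c with h | h
      · exact Or.inl ⟨⟨by linarith [h1.1], by linarith [h1.2]⟩, h2.1.le, h⟩
      · exact Or.inr ⟨Ioo_subset_Icc_self h1, h, h2.2.le⟩
  · have hbox : ∀ a b d e : ℝ,
        volume ((Icc a b ×ˢ Icc d e : Set Plane) \ (Ioo a b ×ˢ Ioo d e)) = 0 := by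
      intro a b d e
      rw [Measure.volume_eq_prod]
      exact ae_le_set.1 (Measure.set_prod_ae_eq Ioo_ae_eq_Icc Ioo_ae_eq_Icc).symm.le
    refine measure_mono_null ?_ (measure_union_null (hbox 0 (3 * c) 0 c) (hbox c (2 * c) c (2 * c)))
    rintro p ⟨h | h, hp⟩
    · exact Or.inl ⟨h, fun h' => hp (Or.inl h')⟩
    · exact Or.inr ⟨h, fun h' => hp (Or.inr ⟨h'.1, hc.trans h'.2.1, h'.2.2⟩)⟩

end TwoRectangles

end MixedDeriv

theorem mainTheorem10 (L : ℝ) (hL : 0 < L) :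
    MixedDeriv.mixedIndecomposable (MixedDeriv.square L) ⊂
        MixedDeriv.gradIndecomposable (MixedDeriv.square L) ∧
      ∀ c : ℝ, 0 < c → 3 * c ≤ L →
        MixedDeriv.twoRectangles c ∈ MixedDeriv.gradIndecomposable (MixedDeriv.square L) ∧
          MixedDeriv.IsMixedDecomposable (MixedDeriv.square L) (MixedDeriv.twoRectangles c) := by
  have htwo : ∀ c : ℝ, 0 < c → 3 * c ≤ L →
      MixedDeriv.twoRectangles c ∈ MixedDeriv.gradIndecomposable (MixedDeriv.square L) ∧
        MixedDeriv.IsMixedDecomposable (MixedDeriv.square L) (MixedDeriv.twoRectangles c) :=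
    fun c hc hcL => ⟨⟨MixedDeriv.isAdmissible_twoRectangles hc hcL,
      MixedDeriv.not_isGradDecomposable_twoRectangles hc⟩,
      MixedDeriv.isMixedDecomposable_twoRectangles hc hcL⟩
  refine ⟨⟨fun A hA => ⟨hA.1, fun h =>
    hA.2 (MixedDeriv.isMixedDecomposable_of_isGradDecomposable h)⟩, fun h => ?_⟩, htwo⟩
  -- The choice `c = L / 3` satisfies `3 * c ≤ L` with equality, so every square contains a set
  -- witnessing strictness.
  obtain ⟨h1, h2⟩ := htwo (L / 3) (by positivity) (by linarith)
  exact (h h1).2 h2
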